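/- Let $f\in C^2(\mathbb R)$ with $f''>0$ on $\mathbb R$, let $u_+<u_-$ and $\alpha>1/2$, and put $$\lambda=\frac{f(u_+)-f(u_-)}{u_+-u_-},\qquad g(v)=f(v)-f(u_-)-\lambda(v-u_-).$$ For $\delta\ge 0$ and $\epsilon>0$, a monotone travelling wave is a strictly decreasing function $v:\mathbb R\to\mathbb R$ (of class $C^2$ if $\delta>0$, of class $C^1$ if $\delta=0$) which satisfies $$-\epsilon\,\frac{v'}{(1+(v')^2)^{\alpha}}=\delta v''-g(v)\quad\text{on }\mathbb R$$ (without the term $\delta v''$ if $\delta=0$) and $(v,v')(\zeta)\to(u_\mp,0)$ as $\zeta\to\mp\infty$. Then the following hold. 1. For every $\delta>0$ there is a smallest $\epsilon>0$, denoted $\epsilon_{\min}(\alpha,\delta)$, for which a monotone travelling wave exists; likewise for $\delta=0$ there is a smallest such $\epsilon>0$, denoted $\epsilon_{\min}(\alpha)$. 2. $\displaystyle\inf_{\delta>0}\epsilon_{\min}(\alpha,\delta)<\epsilon_{\min}(\alpha)$. 3. The function $\delta\mapsto\epsilon_{\min}(\alpha,\delta)$ on $(0,\infty)$ is neither nondecreasing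 nor nonincreasing. 4. It attains its minimum over $(0,\infty)$: there is $\delta_0>0$ with $\epsilon_{\min}(\alpha,\delta_0)\le\epsilon_{\min}(\alpha,\delta)$ for all $\delta>0$. -/

import Mathlib

namespace RosenauKdV

noncomputable section

open Filter Topology

/-- The Rankine-Hugoniot speed of a front from `um` (at `-∞`) to `up` (at `+∞`). -/
def speed (f : ℝ → ℝ) (um up : ℝ) : ℝ := (f up - f um) / (up - um)

/-- The reaction term `g(v) = f(v) - f(u₋) - λ (v - u₋)`. -/
def reaction (f : ℝ → ℝ) (um up v : ℝ) : ℝ := f v - f um - speed f um up * (v - um)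

/-- The saturated flux `s / (1 + s²)^α`. -/
def flux (α s : ℝ) : ℝ := s / (1 + s ^ 2) ^ α

/-- `v` is a (strictly) decreasing profile whose phase-plane curve `(v, v')` connects `(um, 0)` at
`-∞` to `(up, 0)` at `+∞`. -/
structure IsDecreasingFront (um up : ℝ) (v : ℝ → ℝ) : Prop where
  strictAnti : StrictAnti v
  tendsto_atBot : Tendsto v atBot (𝓝 um)
  tendsto_atTop : Tendsto v atTop (𝓝 up)
  deriv_tendsto_atBot : Tendsto (deriv v) atBot (𝓝 0)
  deriv_tendsto_atTop : Tendsto (deriv v) atTop (𝓝 0)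

/-- `v` is a monotone travelling wave of
`-ε v' / (1 + v'²)^α = δ v'' - g(v)` (used for `δ > 0`). -/
structure IsMonotoneWave (f : ℝ → ℝ) (um up α δ ε : ℝ) (v : ℝ → ℝ) : Prop where
  contDiff : ContDiff ℝ 2 v
  front : IsDecreasingFront um up v
  equation : ∀ ζ : ℝ,
    -ε * flux α (deriv v ζ) = δ * deriv (deriv v) ζ - reaction f um up (v ζ)

/-- `v` is a monotone travelling wave of the equation with `δ = 0`, which is of first order, so
that a classical solution is a `C¹` function:
`-ε v' / (1 + v'²)^α = -g(v)`. -/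
structure IsReducedMonotoneWave (f : ℝ → ℝ) (um up α ε : ℝ) (v : ℝ → ℝ) : Prop where
  contDiff : ContDiff ℝ 1 v
  front : IsDecreasingFront um up v
  equation : ∀ ζ : ℝ, -ε * flux α (deriv v ζ) = -reaction f um up (v ζ)

/-- The `ε > 0` for which there is a monotone travelling wave, for given `α` and `δ > 0`. -/
def waveSet (f : ℝ → ℝ) (um up α δ : ℝ) : Set ℝ :=
  {ε | 0 < ε ∧ ∃ v : ℝ → ℝ, IsMonotoneWave f um up α δ ε v}

/-- The `ε > 0` for which there is a monotone travelling wave when `δ = 0`. -/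
def reducedWaveSet (f : ℝ → ℝ) (um up α : ℝ) : Set ℝ :=
  {ε | 0 < ε ∧ ∃ v : ℝ → ℝ, IsReducedMonotoneWave f um up α ε v}

/-- `ε_min(α, δ)`, for `δ > 0`. -/
def epsMin (f : ℝ → ℝ) (um up α δ : ℝ) : ℝ := sInf (waveSet f um up α δ)

/-- `ε_min(α)`, the minimal `ε` of the equation with `δ = 0`. -/
def epsMinReduced (f : ℝ → ℝ) (um up α : ℝ) : ℝ := sInf (reducedWaveSet f um up α)

end

end RosenauKdV

namespace RosenauKdV

open Filter Topology Set

/-! ### The saturated flux: growth, maximum and one-sided estimates -/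

section

/-! Write Φ for the flux, G = -g, L = u₋ - u₊, and describe a wave by its squared slope w = v'² as a
function of t = u₋ - v ∈ [0, L]. For δ > 0 the equation becomes w' = (2/δ) G - (2ε/δ) Φ(√w) with
w(0) = 0, and a wave exists exactly when w(L) = 0. The square root destroys the Lipschitz property
at w = 0. But Φ(s) + 2αs² is nondecreasing on s ≥ 0, so Φ(√w) decreases at rate at most 2α; this
one-sided bound is enough for uniqueness, comparison with supersolutions and continuous dependence
in the direction of increasing t (`IsSlopeSq.abs_sub_le`, `IsSlopeSq.le_of_supersolution`). Hence
the pairs (δ, ε) admitting a connection form a closed set where δ stays away from 0, and minima come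
from compactness (`exists_min_connects`).

For δ = 0 the slope must solve ε Φ(s) = G(v), so the minimal ε is ε₀ = max G / max Φ
(`isLeast_reducedWaveSet`).

Three estimates give the shape of the minimal ε as a function of δ. For some δ it lies below ε₀: a
slope that crosses the maximizer q of Φ with small positive speed as v passes the top of G stays a
supersolution for ε slightly below ε₀, because both maxima are controlled by parabolas
(`exists_connects_lt`). As δ → 0 it cannot stay below any ε₁ < ε₀: near the top of G the excess of G
over ε₁ max Φ forces δ v'² up by a fixed amount, while δ |v'|^(2α+1) stays bounded, and these
conflict because α > 1/2 (`exists_forall_lt_of_isMonotoneWave`). As δ → ∞ it grows at least like √δ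
(`exists_mul_le_sq_of_isMonotoneWave`). A function that is larger near both ends of (0, ∞) than at
an interior point is not monotone, and its minimum over a compact interval is global. -/

theorem flux_eq_mul (α s : ℝ) : flux α s = s * (1 + s ^ 2) ^ (-α) := by
  rw [flux, Real.rpow_neg (by positivity), div_eq_mul_inv]

theorem flux_neg (α s : ℝ) : flux α (-s) = -flux α s := by
  simp [flux, neg_div]

@[simp] theorem flux_zero (α : ℝ) : flux α 0 = 0 := by simp [flux]

theorem flux_pos (α : ℝ) {s : ℝ} (hs : 0 < s) : 0 < flux α s := by
  unfold flux; positivity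

theorem flux_nonneg (α : ℝ) {s : ℝ} (hs : 0 ≤ s) : 0 ≤ flux α s := by
  unfold flux; positivity

theorem hasDerivAt_flux (α s : ℝ) :
    HasDerivAt (flux α) ((1 + s ^ 2) ^ (-α - 1) * (1 - (2 * α - 1) * s ^ 2)) s := by
  have h0 : (0 : ℝ) < 1 + s ^ 2 := by positivity
  have h1 : HasDerivAt (fun x : ℝ => 1 + x ^ 2) (2 * s) s := by
    simpa using (hasDerivAt_pow 2 s).const_add 1
  have h2 := (hasDerivAt_id' s).fun_mul (h1.rpow_const (p := -α) (Or.inl h0.ne'))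
  have h3 : flux α = fun x : ℝ => x * (1 + x ^ 2) ^ (-α) := funext (flux_eq_mul α)
  rw [h3]
  refine h2.congr_deriv ?_
  have h4 : (1 + s ^ 2) ^ (-α) = (1 + s ^ 2) ^ (-α - 1) * (1 + s ^ 2) := by
    rw [← Real.rpow_add_one h0.ne']; ring_nf
  rw [h4]
  ring

theorem continuous_flux (α : ℝ) : Continuous (flux α) :=
  continuous_iff_continuousAt.2 fun s => (hasDerivAt_flux α s).continuousAt

variable {α : ℝ}

theorem one_add_sq_rpow_mul_le (hα : 1 / 2 < α) (s : ℝ) :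
    (1 + s ^ 2) ^ (-α - 1) * (1 + s ^ 2) ≤ 1 := by
  have h0 : (0 : ℝ) < 1 + s ^ 2 := by positivity
  rw [← Real.rpow_add_one h0.ne']
  exact Real.rpow_le_one_of_one_le_of_nonpos (by nlinarith [sq_nonneg s]) (by linarith)

theorem abs_flux_sub_le (hα : 1 / 2 < α) (x y : ℝ) :
    |flux α x - flux α y| ≤ 2 * α * |x - y| := by
  have := Convex.norm_image_sub_le_of_norm_hasDerivWithin_le (f := flux α) (s := univ)
    (C := 2 * α) (fun s _ => (hasDerivAt_flux α s).hasDerivWithinAt) ?_ convex_univ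
    (mem_univ y) (mem_univ x)
  · simpa [Real.norm_eq_abs] using this
  · intro s _
    have h := one_add_sq_rpow_mul_le hα s
    have h1 : (0 : ℝ) < (1 + s ^ 2) ^ (-α - 1) := by positivity
    rw [Real.norm_eq_abs, abs_mul, abs_of_pos h1]
    have h2 : |1 - (2 * α - 1) * s ^ 2| ≤ 2 * α * (1 + s ^ 2) := by
      rw [abs_le]; constructor <;> nlinarith [sq_nonneg s]
    nlinarith

theorem flux_le_self (hα : 1 / 2 < α) {s : ℝ} (hs : 0 ≤ s) : flux α s ≤ s :=
  div_le_self hs (Real.one_le_rpow (by nlinarith [sq_nonneg s]) (by linarith))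

theorem mul_le_flux (hα : 1 / 2 < α) {s P : ℝ} (hs : 0 ≤ s) (hsP : s ≤ P) :
    s * (1 + P ^ 2) ^ (-α) ≤ flux α s := by
  rw [flux_eq_mul]
  refine mul_le_mul_of_nonneg_left ?_ hs
  exact Real.rpow_le_rpow_of_nonpos (by positivity) (by nlinarith) (by linarith)

/-- The flux is monotone up to a quadratic correction. -/
theorem monotoneOn_flux_add_sq (hα : 1 / 2 < α) :
    MonotoneOn (fun s => flux α s + 2 * α * s ^ 2) (Ici 0) := by
  have hd : ∀ s : ℝ, HasDerivAt (fun s => flux α s + 2 * α * s ^ 2)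
      ((1 + s ^ 2) ^ (-α - 1) * (1 - (2 * α - 1) * s ^ 2) + 2 * α * (2 * s)) s := fun s => by
    simpa using (hasDerivAt_flux α s).fun_add ((hasDerivAt_pow 2 s).const_mul (2 * α))
  refine monotoneOn_of_deriv_nonneg (convex_Ici 0)
    (continuous_iff_continuousAt.2 fun s => (hd s).continuousAt).continuousOn
    (fun s _ => (hd s).differentiableAt.differentiableWithinAt) fun s hs => ?_
  rw [interior_Ici] at hs
  have hs : 0 < s := hs
  rw [(hd s).deriv]
  have h := one_add_sq_rpow_mul_le hα s
  have h1 : (0 : ℝ) < (1 + s ^ 2) ^ (-α - 1) := by positivity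
  -- The negative part of the derivative is (2α - 1) s times this quantity, hence at most (2α - 1)
  -- s, which the added 4αs dominates.
  have h2 : (1 + s ^ 2) ^ (-α - 1) * s ≤ 1 := by
    nlinarith [sq_nonneg (s - 1), mul_nonneg h1.le (sq_nonneg (s - 1))]
  have h3 : (2 * α - 1) * s * ((1 + s ^ 2) ^ (-α - 1) * s) ≤ (2 * α - 1) * s * 1 :=
    mul_le_mul_of_nonneg_left h2 (mul_nonneg (by linarith) hs.le)
  nlinarith

/-- The argument at which the flux is maximal. -/
noncomputable def critSlope (α : ℝ) : ℝ := (√(2 * α - 1))⁻¹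

theorem critSlope_pos (hα : 1 / 2 < α) : 0 < critSlope α :=
  inv_pos.2 (Real.sqrt_pos.2 (by linarith))

theorem critSlope_sq (hα : 1 / 2 < α) : (2 * α - 1) * critSlope α ^ 2 = 1 := by
  have : 0 < 2 * α - 1 := by linarith
  rw [critSlope, inv_pow, Real.sq_sqrt this.le, mul_inv_cancel₀ this.ne']

theorem strictMonoOn_flux (hα : 1 / 2 < α) : StrictMonoOn (flux α) (Icc 0 (critSlope α)) := by
  refine strictMonoOn_of_deriv_pos (convex_Icc _ _) (continuous_flux α).continuousOn fun s hs => ?_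
  rw [interior_Icc] at hs
  rw [(hasDerivAt_flux α s).deriv]
  have := critSlope_sq hα
  have h2 : s ^ 2 < critSlope α ^ 2 := by nlinarith [hs.1, hs.2]
  have : 0 < 1 - (2 * α - 1) * s ^ 2 := by nlinarith
  positivity

theorem antitoneOn_flux (hα : 1 / 2 < α) : AntitoneOn (flux α) (Ici (critSlope α)) := by
  refine antitoneOn_of_deriv_nonpos (convex_Ici _) (continuous_flux α).continuousOn
    (fun s _ => (hasDerivAt_flux α s).differentiableAt.differentiableWithinAt) fun s hs => ?_
  rw [interior_Ici] at hs
  have hs : critSlope α < s := hs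
  rw [(hasDerivAt_flux α s).deriv]
  have := critSlope_sq hα
  have h2 : critSlope α ^ 2 < s ^ 2 := by nlinarith [critSlope_pos hα]
  have : 1 - (2 * α - 1) * s ^ 2 ≤ 0 := by nlinarith
  exact mul_nonpos_of_nonneg_of_nonpos (by positivity) this

theorem flux_le_max (hα : 1 / 2 < α) {s : ℝ} (hs : 0 ≤ s) : flux α s ≤ flux α (critSlope α) := by
  rcases le_total s (critSlope α) with h | h
  · exact (strictMonoOn_flux hα).monotoneOn ⟨hs, h⟩ ⟨(critSlope_pos hα).le, le_rfl⟩ h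
  · exact antitoneOn_flux hα self_mem_Ici h h

theorem flux_max_pos (hα : 1 / 2 < α) : 0 < flux α (critSlope α) :=
  flux_pos α (critSlope_pos hα)

/-- Near its maximum the flux is bounded below by a parabola. -/
theorem flux_max_sub_sq_le (hα : 1 / 2 < α) : ∃ b > 0, ∀ s ∈ Icc 0 (2 * critSlope α),
    flux α (critSlope α) - b * (s - critSlope α) ^ 2 ≤ flux α s := by
  set q := critSlope α with hq
  have hq0 : 0 < q := critSlope_pos hα
  have hq2 : (2 * α - 1) * q ^ 2 = 1 := critSlope_sq hα
  have ha : 0 < 2 * α - 1 := by linarith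
  -- Since (2α - 1) q² = 1, the derivative of the flux is -(1 + s²)^(-α-1) (2α - 1)(s + q)(s - q),
  -- and s + q ≤ 3q on [0, 2q].
  set b := (2 * α - 1) * (3 * q) with hb
  have hb0 : 0 < b := by positivity
  have hd : ∀ s : ℝ, HasDerivAt (fun s => flux α s + b * (s - q) ^ 2)
      ((1 + s ^ 2) ^ (-α - 1) * (1 - (2 * α - 1) * s ^ 2) + b * (2 * (s - q))) s := fun s => by
    have := (((hasDerivAt_id s).sub_const q).pow 2).const_mul b
    simpa using (hasDerivAt_flux α s).fun_add this
  have hc : Continuous (fun s => flux α s + b * (s - q) ^ 2) :=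
    continuous_iff_continuousAt.2 fun s => (hd s).continuousAt
  have key : ∀ s ∈ Icc 0 (2 * q), ∃ r : ℝ, 0 ≤ r ∧
      (1 + s ^ 2) ^ (-α - 1) * (1 - (2 * α - 1) * s ^ 2) + b * (2 * (s - q)) = r * (s - q) := by
    intro s hs
    refine ⟨2 * b - (1 + s ^ 2) ^ (-α - 1) * ((2 * α - 1) * (q + s)), ?_, ?_⟩
    · have h1 : (1 + s ^ 2) ^ (-α - 1) ≤ 1 :=
        Real.rpow_le_one_of_one_le_of_nonpos (by nlinarith [sq_nonneg s]) (by linarith)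
      have h2 : 0 ≤ (2 * α - 1) * (q + s) := mul_nonneg ha.le (by linarith [hs.1])
      have h3 : (2 * α - 1) * (q + s) ≤ b := by
        rw [hb]; exact mul_le_mul_of_nonneg_left (by linarith [hs.2]) ha.le
      nlinarith
    · linear_combination (-(1 + s ^ 2) ^ (-α - 1)) * hq2
  refine ⟨b, hb0, fun s hs => ?_⟩
  suffices h : flux α q + b * (q - q) ^ 2 ≤ flux α s + b * (s - q) ^ 2 by
    simp at h; linarith
  rcases le_total s q with h | h
  · have : AntitoneOn (fun s => flux α s + b * (s - q) ^ 2) (Icc 0 q) := by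
      refine antitoneOn_of_deriv_nonpos (convex_Icc _ _) hc.continuousOn
        (fun s _ => (hd s).differentiableAt.differentiableWithinAt) fun s hs => ?_
      rw [interior_Icc] at hs
      obtain ⟨r, hr, hr'⟩ := key s ⟨hs.1.le, by linarith [hs.2]⟩
      rw [(hd s).deriv, hr']
      exact mul_nonpos_of_nonneg_of_nonpos hr (by linarith [hs.2])
    exact this ⟨hs.1, h⟩ ⟨hq0.le, le_rfl⟩ h
  · have : MonotoneOn (fun s => flux α s + b * (s - q) ^ 2) (Icc q (2 * q)) := by
      refine monotoneOn_of_deriv_nonneg (convex_Icc _ _) hc.continuousOn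
        (fun s _ => (hd s).differentiableAt.differentiableWithinAt) fun s hs => ?_
      rw [interior_Icc] at hs
      obtain ⟨r, hr, hr'⟩ := key s ⟨by linarith [hs.1], hs.2.le⟩
      rw [(hd s).deriv, hr']
      exact mul_nonneg hr (by linarith [hs.1])
    exact this ⟨le_rfl, by linarith⟩ ⟨h, hs.2⟩ h

end

/-! ### The singular initial value problem for the squared slope -/

section

/-- A one-sided Gronwall inequality: the differential inequality is only needed where the
function is positive. -/
theorem le_of_deriv_le_where_pos {d d' : ℝ → ℝ} {a b K e : ℝ} (hK : 0 ≤ K) (he : 0 ≤ e)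
    (hd : ContinuousOn d (Icc a b)) (hd' : ∀ t ∈ Ioo a b, HasDerivAt d (d' t) t) (ha : d a ≤ 0)
    (bound : ∀ t ∈ Ioo a b, 0 < d t → d' t ≤ K * d t + e) :
    ∀ t ∈ Icc a b, d t ≤ e * (t - a) * Real.exp (K * (t - a)) := by
  intro t ht
  rcases eq_or_lt_of_le ht.1 with rfl | hat
  · simpa using ha
  have hc : 0 < (1 + (t - a)) * Real.exp (K * (t - a)) :=
    mul_pos (by linarith) (Real.exp_pos _)
  refine le_of_forall_pos_le_add fun ε hε => ?_
  -- The η-term turns the barrier into a strict supersolution that is positive already at `a`; its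
  -- contribution at `t` is exactly ε.
  set η := ε / ((1 + (t - a)) * Real.exp (K * (t - a))) with hη
  have hη0 : 0 < η := div_pos hε hc
  set B : ℝ → ℝ := fun s => (e * (s - a) + η * (1 + (s - a))) * Real.exp (K * (s - a)) with hB
  have hBd : ∀ s, HasDerivAt B (K * B s + (e + η) * Real.exp (K * (s - a))) s := fun s => by
    have h1 : HasDerivAt (fun s => e * (s - a) + η * (1 + (s - a))) (e + η) s := by
      have := ((hasDerivAt_id' s).sub_const a)
      refine ((this.const_mul e).fun_add ((this.const_add 1).const_mul η)).congr_deriv (by ring)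
    have h2 : HasDerivAt (fun s => Real.exp (K * (s - a))) (Real.exp (K * (s - a)) * K) s := by
      refine (((hasDerivAt_id' s).sub_const a).const_mul K).exp.congr_deriv (by ring)
    refine (h1.fun_mul h2).congr_deriv ?_
    simp only [hB]; ring
  have hBpos : ∀ s, a ≤ s → η ≤ B s := fun s hs => by
    have h1 : 1 ≤ Real.exp (K * (s - a)) := Real.one_le_exp (mul_nonneg hK (by linarith))
    have h2 : η ≤ e * (s - a) + η * (1 + (s - a)) := by
      nlinarith [mul_nonneg he (sub_nonneg.2 hs), mul_nonneg hη0.le (sub_nonneg.2 hs)]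
    calc η ≤ e * (s - a) + η * (1 + (s - a)) := h2
      _ ≤ B s := le_mul_of_one_le_right (hη0.le.trans h2) h1
  -- No derivative is available at `a` itself, so the comparison starts slightly to its right, where
  -- `d` is still below the barrier.
  obtain ⟨a', ha', hda'⟩ : ∃ a' ∈ Ioo a t, d a' < η := by
    have h1 : ∀ᶠ s in 𝓝[Icc a b] a, d s < η :=
      (hd a ⟨le_rfl, hat.le.trans ht.2⟩).eventually_lt_const (lt_of_le_of_lt ha hη0)
    have h2 : ∀ᶠ s in 𝓝[>] a, d s < η := by
      have : 𝓝[Ioo a b] a = 𝓝[>] a := nhdsWithin_Ioo_eq_nhdsGT (hat.trans_le ht.2)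
      rw [← this]
      exact h1.filter_mono (nhdsWithin_mono _ Ioo_subset_Icc_self)
    obtain ⟨s, hs, hs'⟩ := (h2.and (Ioo_mem_nhdsGT hat)).exists
    exact ⟨s, hs', hs⟩
  have := image_le_of_deriv_right_lt_deriv_boundary' (f := d) (f' := d') (a := a') (b := b)
    (hd.mono (Icc_subset_Icc_left ha'.1.le))
    (fun x hx => (hd' x ⟨ha'.1.trans_le hx.1, hx.2⟩).hasDerivWithinAt)
    (hda'.le.trans (hBpos a' ha'.1.le))
    (fun x _ => (hBd x).continuousAt.continuousWithinAt)
    (fun x _ => (hBd x).hasDerivWithinAt)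
    (fun x hx hxe => by
      have hxa : a ≤ x := ha'.1.le.trans hx.1
      have h1 := bound x ⟨ha'.1.trans_le hx.1, hx.2⟩ (by
        rw [hxe]; exact hη0.trans_le (hBpos x hxa))
      have h2 : 1 ≤ Real.exp (K * (x - a)) := Real.one_le_exp (mul_nonneg hK (by linarith))
      rw [hxe] at h1
      nlinarith) ⟨ha'.2.le, ht.2⟩
  refine this.trans (le_of_eq ?_)
  have : η * ((1 + (t - a)) * Real.exp (K * (t - a))) = ε := div_mul_cancel₀ _ hc.ne'
  simp only [hB]
  linear_combination this

/-- The flux as a function of the squared slope, regularized by a shift `h ≥ 0`. -/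
noncomputable def sqFlux (α h w : ℝ) : ℝ := flux α √(max w 0 + h)

theorem sqFlux_zero_of_nonneg (α : ℝ) {w : ℝ} (hw : 0 ≤ w) : sqFlux α 0 w = flux α √w := by
  simp [sqFlux, max_eq_left hw]

theorem sqFlux_zero_of_nonpos (α : ℝ) {w : ℝ} (hw : w ≤ 0) : sqFlux α 0 w = 0 := by
  simp [sqFlux, max_eq_right hw]

theorem sqFlux_nonneg (α h w : ℝ) : 0 ≤ sqFlux α h w := flux_nonneg α (Real.sqrt_nonneg _)

variable {α : ℝ}

theorem sqFlux_le_max (hα : 1 / 2 < α) (h w : ℝ) : sqFlux α h w ≤ flux α (critSlope α) :=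
  flux_le_max hα (Real.sqrt_nonneg _)

/-- In the variable w = s² the correction 2αs² is linear, so the monotonicity of Φ(s) + 2αs² becomes
a one-sided Lipschitz bound, uniform in h. The singularity of √w at 0 only makes the flux increase
fast, which is the harmless direction. -/
theorem sqFlux_sub_le (hα : 1 / 2 < α) {h : ℝ} (hh : 0 ≤ h) {x y : ℝ} (hxy : y ≤ x) :
    sqFlux α h y - sqFlux α h x ≤ 2 * α * (x - y) := by
  have hy : 0 ≤ max y 0 + h := add_nonneg (le_max_right _ _) hh
  have hx : 0 ≤ max x 0 + h := add_nonneg (le_max_right _ _) hh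
  have hm : max y 0 ≤ max x 0 := max_le_max_right 0 hxy
  have h1 := monotoneOn_flux_add_sq hα (Real.sqrt_nonneg (max y 0 + h))
    (Real.sqrt_nonneg (max x 0 + h)) (Real.sqrt_le_sqrt (by linarith))
  simp only [Real.sq_sqrt hy, Real.sq_sqrt hx] at h1
  have h2 : max x 0 - max y 0 ≤ x - y := by
    rcases le_total x 0 with h3 | h3 <;> rcases le_total y 0 with h4 | h4 <;>
      simp [h3, h4] <;> linarith
  unfold sqFlux
  nlinarith

theorem abs_sqrt_sub_sqrt_le {x y : ℝ} (hx : 0 ≤ x) (hy : 0 ≤ y) : |√x - √y| ≤ √|x - y| := by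
  have key : ∀ {x y : ℝ}, 0 ≤ y → y ≤ x → √x - √y ≤ √(x - y) := fun {x y} hy hyx => by
    have h1 : √x ≤ √(x - y) + √y := by
      rw [Real.sqrt_le_left (by positivity)]
      nlinarith [Real.sq_sqrt hy, Real.sq_sqrt (sub_nonneg.2 hyx), Real.sqrt_nonneg y,
        Real.sqrt_nonneg (x - y), mul_nonneg (Real.sqrt_nonneg y) (Real.sqrt_nonneg (x - y))]
    linarith
  rcases le_total y x with h | h
  · rw [abs_of_nonneg (sub_nonneg.2 (Real.sqrt_le_sqrt h)), abs_of_nonneg (sub_nonneg.2 h)]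
    exact key hy h
  · rw [abs_sub_comm, abs_sub_comm x, abs_of_nonneg (sub_nonneg.2 (Real.sqrt_le_sqrt h)),
      abs_of_nonneg (sub_nonneg.2 h)]
    exact key hx h

theorem abs_sqFlux_sub_le_sqrt (hα : 1 / 2 < α) {h h' : ℝ} (hh : 0 ≤ h) (hh' : 0 ≤ h') (x y : ℝ) :
    |sqFlux α h x - sqFlux α h' y| ≤ 2 * α * √(|x - y| + |h - h'|) := by
  refine (abs_flux_sub_le hα _ _).trans (mul_le_mul_of_nonneg_left ?_ (by linarith))
  refine (abs_sqrt_sub_sqrt_le (add_nonneg (le_max_right _ _) hh)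
    (add_nonneg (le_max_right _ _) hh')).trans (Real.sqrt_le_sqrt ?_)
  rw [add_sub_add_comm]
  exact (abs_add_le _ _).trans (add_le_add_left (abs_max_sub_max_le_abs x y 0) _)

theorem abs_sqFlux_sub_le (hα : 1 / 2 < α) {h : ℝ} (hh : 0 < h) (x y : ℝ) :
    |sqFlux α h x - sqFlux α h y| ≤ 2 * α / √h * |x - y| := by
  have hx : h ≤ max x 0 + h := le_add_of_nonneg_left (le_max_right _ _)
  have hy : h ≤ max y 0 + h := le_add_of_nonneg_left (le_max_right _ _)
  have hs : 0 < √h := Real.sqrt_pos.2 hh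
  refine (abs_flux_sub_le hα _ _).trans ?_
  rw [div_mul_eq_mul_div, mul_div_assoc]
  refine mul_le_mul_of_nonneg_left ?_ (by linarith)
  rw [le_div_iff₀ hs]
  set a := √(max x 0 + h)
  set b := √(max y 0 + h)
  have ha : √h ≤ a := Real.sqrt_le_sqrt hx
  have hb : 0 ≤ b := Real.sqrt_nonneg _
  have h1 : |a - b| * (a + b) = |max x 0 - max y 0| := by
    rw [← abs_of_nonneg (show 0 ≤ a + b by linarith), ← abs_mul]
    congr 1
    have h2 : a ^ 2 = max x 0 + h := Real.sq_sqrt (by linarith)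
    have h3 : b ^ 2 = max y 0 + h := Real.sq_sqrt (by linarith)
    linear_combination h2 - h3
  calc |a - b| * √h ≤ |a - b| * (a + b) := by gcongr; linarith
    _ = |max x 0 - max y 0| := h1
    _ ≤ |x - y| := abs_max_sub_max_le_abs x y 0

/-- `w` solves `w' = A G - B sqFlux(w)`, `w 0 = 0` on `[0, L]`. -/
structure IsSlopeSq (α h A B L : ℝ) (G w : ℝ → ℝ) : Prop where
  continuousOn : ContinuousOn w (Icc 0 L)
  zero : w 0 = 0
  hasDerivAt : ∀ t ∈ Ioo 0 L, HasDerivAt w (A * G t - B * sqFlux α h (w t)) t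

/-- Where w₁ > w₂, the derivative of w₁ - w₂ is at most 2αB₂(w₁ - w₂) plus the errors of the
coefficients and of the two shifts, so the one-sided Gronwall inequality applies. The shifts are
compared through h = 0, each at cost 2α√h. -/
theorem IsSlopeSq.sub_le (hα : 1 / 2 < α) {h₁ h₂ A₁ A₂ B₁ B₂ L Γ : ℝ} {G w₁ w₂ : ℝ → ℝ}
    (H₁ : IsSlopeSq α h₁ A₁ B₁ L G w₁) (H₂ : IsSlopeSq α h₂ A₂ B₂ L G w₂) (hh₁ : 0 ≤ h₁)
    (hh₂ : 0 ≤ h₂) (hB : 0 ≤ B₂) (hG : ∀ t ∈ Icc 0 L, |G t| ≤ Γ) (hΓ : 0 ≤ Γ) :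
    ∀ t ∈ Icc 0 L, w₁ t - w₂ t ≤
      (|A₁ - A₂| * Γ + |B₁ - B₂| * flux α (critSlope α) + B₂ * (2 * α * (√h₁ + √h₂))) *
        L * Real.exp (B₂ * (2 * α) * L) := by
  intro t ht
  have hM := (flux_max_pos hα).le
  have hα0 : 0 ≤ 2 * α := by linarith
  have he : 0 ≤ |A₁ - A₂| * Γ + |B₁ - B₂| * flux α (critSlope α) +
      B₂ * (2 * α * (√h₁ + √h₂)) := by positivity
  have key := le_of_deriv_le_where_pos (d := fun t => w₁ t - w₂ t) (K := B₂ * (2 * α))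
    (by positivity) he (H₁.continuousOn.sub H₂.continuousOn)
    (fun t ht => (H₁.hasDerivAt t ht).sub (H₂.hasDerivAt t ht)) (by simp [H₁.zero, H₂.zero])
    (fun t ht hpos => by
      have e1 : (A₁ - A₂) * G t ≤ |A₁ - A₂| * Γ := (le_abs_self _).trans (by
        rw [abs_mul]
        exact mul_le_mul_of_nonneg_left (hG t (Ioo_subset_Icc_self ht)) (abs_nonneg _))
      have e2 : -((B₁ - B₂) * sqFlux α h₁ (w₁ t)) ≤ |B₁ - B₂| * flux α (critSlope α) :=
        (neg_le_abs _).trans (by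
          rw [abs_mul, abs_of_nonneg (sqFlux_nonneg α h₁ (w₁ t))]
          exact mul_le_mul_of_nonneg_left (sqFlux_le_max hα _ _) (abs_nonneg _))
      have e3 : sqFlux α 0 (w₁ t) - sqFlux α h₁ (w₁ t) ≤ 2 * α * √h₁ := by
        refine (le_abs_self _).trans ((abs_sqFlux_sub_le_sqrt hα le_rfl hh₁ _ _).trans (le_of_eq ?_))
        simp [abs_of_nonneg hh₁]
      have e4 : sqFlux α h₂ (w₂ t) - sqFlux α 0 (w₂ t) ≤ 2 * α * √h₂ := by
        refine (le_abs_self _).trans ((abs_sqFlux_sub_le_sqrt hα hh₂ le_rfl _ _).trans (le_of_eq ?_))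
        simp [abs_of_nonneg hh₂]
      have e5 := sqFlux_sub_le hα le_rfl (sub_pos.1 hpos).le
      have e6 := mul_le_mul_of_nonneg_left (add_le_add (add_le_add e3 e4) e5) hB
      nlinarith) t ht
  refine key.trans ?_
  rw [sub_zero]
  have h0 : 0 ≤ t := ht.1
  have : t ≤ L := ht.2
  have hL : 0 ≤ L := h0.trans this
  gcongr

theorem IsSlopeSq.abs_sub_le (hα : 1 / 2 < α) {h₁ h₂ A₁ A₂ B₁ B₂ L Γ E : ℝ} {G w₁ w₂ : ℝ → ℝ}
    (H₁ : IsSlopeSq α h₁ A₁ B₁ L G w₁) (H₂ : IsSlopeSq α h₂ A₂ B₂ L G w₂) (hh₁ : 0 ≤ h₁)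
    (hh₂ : 0 ≤ h₂) (hB₁ : 0 ≤ B₁) (hB₂ : 0 ≤ B₂) (hE₁ : B₁ ≤ E) (hE₂ : B₂ ≤ E)
    (hG : ∀ t ∈ Icc 0 L, |G t| ≤ Γ) (hΓ : 0 ≤ Γ) :
    ∀ t ∈ Icc 0 L, |w₁ t - w₂ t| ≤
      (|A₁ - A₂| * Γ + |B₁ - B₂| * flux α (critSlope α) + E * (2 * α * (√h₁ + √h₂))) *
        L * Real.exp (E * (2 * α) * L) := by
  intro t ht
  have hM := (flux_max_pos hα).le
  have hα0 : 0 ≤ 2 * α := by linarith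
  have hL : 0 ≤ L := ht.1.trans ht.2
  have hE : 0 ≤ E := hB₁.trans hE₁
  rw [abs_sub_le_iff]
  constructor
  · refine (H₁.sub_le hα H₂ hh₁ hh₂ hB₂ hG hΓ t ht).trans ?_
    gcongr
  · refine (H₂.sub_le hα H₁ hh₂ hh₁ hB₁ hG hΓ t ht).trans ?_
    rw [abs_sub_comm A₂, abs_sub_comm B₂, add_comm √h₂]
    gcongr

/-- Comparison with a supersolution. -/
theorem IsSlopeSq.le_of_supersolution (hα : 1 / 2 < α) {A B L a b : ℝ} {G w z z' : ℝ → ℝ}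
    (H : IsSlopeSq α 0 A B L G w) (hB : 0 ≤ B) (ha : 0 ≤ a) (hb : b ≤ L)
    (hz : ContinuousOn z (Icc a b)) (hz' : ∀ t ∈ Ioo a b, HasDerivAt z (z' t) t)
    (hle : w a ≤ z a) (hsup : ∀ t ∈ Ioo a b, A * G t - B * sqFlux α 0 (z t) ≤ z' t) :
    ∀ t ∈ Icc a b, w t ≤ z t := by
  intro t ht
  have key := le_of_deriv_le_where_pos (d := fun t => w t - z t) (K := B * (2 * α))
    (mul_nonneg hB (by linarith)) le_rfl ((H.continuousOn.mono (Icc_subset_Icc ha hb)).sub hz)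
    (fun t ht => (H.hasDerivAt t ⟨ha.trans_lt ht.1, ht.2.trans_le hb⟩).sub (hz' t ht))
    (sub_nonpos.2 hle)
    (fun t ht hpos => by
      have e5 := mul_le_mul_of_nonneg_left (sqFlux_sub_le hα le_rfl (sub_pos.1 hpos).le) hB
      have := hsup t ht
      linarith) t ht
  simpa using key

/-- The flux is cut off where w is negative, so there w' = A G ≥ 0 and w cannot descend from 0. -/
theorem IsSlopeSq.nonneg {A B L : ℝ} {G w : ℝ → ℝ} (H : IsSlopeSq α 0 A B L G w) (hA : 0 ≤ A)
    (hG : ∀ t ∈ Ioo 0 L, 0 < G t) : ∀ t ∈ Icc 0 L, 0 ≤ w t := by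
  intro t ht
  have key := le_of_deriv_le_where_pos (d := fun t => - w t) (K := 0) le_rfl le_rfl
    H.continuousOn.neg (fun t ht => (H.hasDerivAt t ht).neg) (by simp [H.zero])
    (fun t ht hpos => by
      rw [sqFlux_zero_of_nonpos α (by linarith)]
      have := mul_nonneg hA (hG t ht).le
      linarith) t ht
  simpa using key

/-- An interior zero would be a minimum, yet w' = A G > 0 wherever w = 0. -/
theorem IsSlopeSq.pos {A B L : ℝ} {G w : ℝ → ℝ} (H : IsSlopeSq α 0 A B L G w) (hA : 0 < A)
    (hG : ∀ t ∈ Ioo 0 L, 0 < G t) : ∀ t ∈ Ioo 0 L, 0 < w t := by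
  intro t ht
  refine lt_of_le_of_ne (H.nonneg hA.le hG t (Ioo_subset_Icc_self ht)) fun h0 => ?_
  have hmin : IsLocalMin w t := by
    filter_upwards [isOpen_Ioo.mem_nhds ht] with s hs
    rw [← h0]
    exact H.nonneg hA.le hG s (Ioo_subset_Icc_self hs)
  have h1 := hmin.hasDerivAt_eq_zero (H.hasDerivAt t ht)
  rw [sqFlux_zero_of_nonpos α h0.symm.le] at h1
  have := mul_pos hA (hG t ht)
  linarith

/-- The shift makes the right-hand side Lipschitz in w, and it is bounded, so Picard–Lindelöf covers
all of [0, L]. -/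
theorem exists_isSlopeSq_of_pos (hα : 1 / 2 < α) {h A B L Γ : ℝ} {G : ℝ → ℝ} (hh : 0 < h)
    (hL : 0 ≤ L) (hGc : Continuous G) (hG : ∀ t ∈ Icc 0 L, |G t| ≤ Γ) (hΓ : 0 ≤ Γ) :
    ∃ w, IsSlopeSq α h A B L G w := by
  have hα0 : 0 ≤ 2 * α := by linarith
  have hM := (flux_max_pos hα).le
  set Q : NNReal := ⟨|A| * Γ + |B| * flux α (critSlope α), by positivity⟩ with hQ
  set K : NNReal := ⟨|B| * (2 * α / √h), by positivity⟩ with hK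
  have hP : IsPicardLindelof (fun t x => A * G t - B * sqFlux α h x)
      (⟨0, le_rfl, hL⟩ : Icc 0 L) 0 (Q * ⟨L, hL⟩) 0 Q K := by
    refine ⟨fun t _ => ?_, fun x _ => ?_, fun t ht x _ => ?_, ?_⟩
    · refine LipschitzOnWith.of_dist_le_mul fun x _ y _ => ?_
      rw [Real.dist_eq, Real.dist_eq, sub_sub_sub_cancel_left, ← mul_sub, abs_mul, abs_sub_comm]
      change _ ≤ |B| * (2 * α / √h) * |x - y|
      rw [mul_assoc]
      exact mul_le_mul_of_nonneg_left (abs_sqFlux_sub_le hα hh x y) (abs_nonneg _)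
    · exact ((continuous_const.mul hGc).sub continuous_const).continuousOn
    · rw [Real.norm_eq_abs]
      refine (abs_sub _ _).trans ?_
      rw [abs_mul, abs_mul, abs_of_nonneg (sqFlux_nonneg α h x)]
      exact add_le_add (mul_le_mul_of_nonneg_left (hG t ht) (abs_nonneg _))
        (mul_le_mul_of_nonneg_left (sqFlux_le_max hα _ _) (abs_nonneg _))
    · have : ((Q * ⟨L, hL⟩ : NNReal) : ℝ) = Q * L := rfl
      simp [hL, this]
  obtain ⟨w, hw0, hw⟩ := hP.exists_eq_forall_mem_Icc_hasDerivWithinAt₀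
  exact ⟨w, fun t ht => (hw t ht).continuousWithinAt, hw0, fun t ht =>
    (hw t (Ioo_subset_Icc_self ht)).hasDerivAt (Icc_mem_nhds ht.1 ht.2)⟩

/-- The shifted solutions are uniformly Cauchy by the stability estimate. The flux is Hölder
continuous of order 1/2 in w, so the derivatives converge uniformly too. The shifts are squares r²
so that the error is linear in r. -/
theorem exists_isSlopeSq (hα : 1 / 2 < α) {A B L Γ : ℝ} {G : ℝ → ℝ} (hB : 0 ≤ B)
    (hL : 0 ≤ L) (hGc : Continuous G) (hG : ∀ t ∈ Icc 0 L, |G t| ≤ Γ) (hΓ : 0 ≤ Γ) :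
    ∃ w, IsSlopeSq α 0 A B L G w := by
  have hα0 : 0 ≤ 2 * α := by linarith
  set r : ℕ → ℝ := fun n => 1 / ((n : ℝ) + 1) with hr
  have hr0 : ∀ n, 0 < r n := fun n => by positivity
  have hrlim : Tendsto r atTop (𝓝 0) := tendsto_one_div_add_atTop_nhds_zero_nat
  have hranti : Antitone r := fun m n hmn => one_div_le_one_div_of_le (by positivity)
    (by exact_mod_cast Nat.succ_le_succ hmn)
  choose u hu using fun n => exists_isSlopeSq_of_pos (A := A) (B := B) hα
    (show 0 < r n ^ 2 from pow_pos (hr0 n) 2) hL hGc hG hΓ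
  set c := B * (2 * α) * L * Real.exp (B * (2 * α) * L) with hc
  have hc0 : 0 ≤ c := by positivity
  have hcau : ∀ n m, ∀ t ∈ Icc 0 L, |u n t - u m t| ≤ c * (r n + r m) := by
    intro n m t ht
    refine ((hu n).abs_sub_le hα (hu m) (sq_nonneg _) (sq_nonneg _) hB hB le_rfl le_rfl hG hΓ t
      ht).trans (le_of_eq ?_)
    rw [Real.sqrt_sq (hr0 n).le, Real.sqrt_sq (hr0 m).le, sub_self, sub_self, abs_zero, hc]
    ring
  have hlim : ∀ t ∈ Icc 0 L, ∃ x, Tendsto (fun n => u n t) atTop (𝓝 x) := by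
    intro t ht
    refine cauchySeq_tendsto_of_complete (cauchySeq_of_le_tendsto_0 (fun n => c * (r n + r n))
      (fun n m N hn hm => ?_) ?_)
    · rw [Real.dist_eq]
      exact (hcau n m t ht).trans
        (mul_le_mul_of_nonneg_left (add_le_add (hranti hn) (hranti hm)) hc0)
    · simpa using (hrlim.add hrlim).const_mul c
  choose! w hw using hlim
  have hdist : ∀ n, ∀ t ∈ Icc 0 L, |u n t - w t| ≤ c * r n := by
    intro n t ht
    have h1 : Tendsto (fun m => |u n t - u m t|) atTop (𝓝 |u n t - w t|) :=
      ((hw t ht).const_sub (u n t)).abs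
    have h2 : Tendsto (fun m => c * (r n + r m)) atTop (𝓝 (c * r n)) := by
      simpa using (hrlim.const_add (r n)).const_mul c
    exact le_of_tendsto_of_tendsto' h1 h2 fun m => hcau n m t ht
  have hunif : TendstoUniformlyOn u w atTop (Icc 0 L) := by
    rw [Metric.tendstoUniformlyOn_iff]
    intro ε hε
    have : Tendsto (fun n => c * r n) atTop (𝓝 0) := by simpa using hrlim.const_mul c
    filter_upwards [this.eventually_lt_const hε] with n hn t ht
    rw [dist_comm, Real.dist_eq]
    exact (hdist n t ht).trans_lt hn
  have h0 : (0 : ℝ) ∈ Icc 0 L := ⟨le_rfl, hL⟩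
  refine ⟨w, hunif.continuousOn (Frequently.of_forall fun n => (hu n).continuousOn), ?_, ?_⟩
  · refine tendsto_nhds_unique (hw 0 h0) ?_
    simp only [(hu _).zero]
    exact tendsto_const_nhds
  · intro t ht
    refine hasDerivAt_of_tendstoUniformlyOn (l := atTop) (f := u)
      (f' := fun n t => A * G t - B * sqFlux α (r n ^ 2) (u n t))
      (g' := fun t => A * G t - B * sqFlux α 0 (w t)) isOpen_Ioo ?_
      (Eventually.of_forall fun n => (hu n).hasDerivAt)
      (fun x hx => hw x (Ioo_subset_Icc_self hx)) ht
    rw [Metric.tendstoUniformlyOn_iff]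
    intro ε hε
    have h1 : Tendsto (fun n => B * (2 * α * √(c * r n + r n ^ 2))) atTop (𝓝 0) := by
      have h2 : Tendsto (fun n => c * r n + r n ^ 2) atTop (𝓝 0) := by
        simpa using (hrlim.const_mul c).add (hrlim.pow 2)
      simpa using ((h2.sqrt).const_mul (2 * α)).const_mul B
    filter_upwards [h1.eventually_lt_const hε] with n hn s hs
    rw [dist_comm, Real.dist_eq, sub_sub_sub_cancel_left, ← mul_sub, abs_mul, abs_of_nonneg hB]
    refine lt_of_le_of_lt (mul_le_mul_of_nonneg_left ?_ hB) hn
    rw [abs_sub_comm]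
    refine (abs_sqFlux_sub_le_sqrt hα (sq_nonneg _) le_rfl _ _).trans ?_
    have := hdist n s (Ioo_subset_Icc_self hs)
    rw [sub_zero, abs_of_nonneg (sq_nonneg (r n))]
    gcongr

end

/-! ### The reaction term: convexity and bounds near its zeros -/

section

variable {f : ℝ → ℝ} {um up : ℝ}

@[simp] theorem reaction_left (f : ℝ → ℝ) (um up : ℝ) : reaction f um up um = 0 := by
  simp [reaction]

theorem reaction_right (f : ℝ → ℝ) (hu : up < um) : reaction f um up up = 0 := by
  have : up - um ≠ 0 := by linarith
  rw [reaction, speed, div_mul_cancel₀ _ this]; ring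

theorem hasDerivAt_reaction (hf : ContDiff ℝ 2 f) (v : ℝ) :
    HasDerivAt (reaction f um up) (deriv f v - speed f um up) v := by
  have h1 := ((hf.differentiable (by norm_num)) v).hasDerivAt
  have h2 := ((hasDerivAt_id' v).sub_const um).const_mul (speed f um up)
  refine ((h1.sub_const (f um)).fun_sub h2).congr_deriv (by ring)

theorem continuous_reaction (hf : ContDiff ℝ 2 f) : Continuous (reaction f um up) :=
  continuous_iff_continuousAt.2 fun v => (hasDerivAt_reaction hf v).continuousAt

theorem contDiff_deriv (hf : ContDiff ℝ 2 f) : ContDiff ℝ 1 (deriv f) :=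
  ((contDiff_succ_iff_deriv (n := 1)).1 (by simpa [one_add_one_eq_two] using hf)).2.2

theorem strictConvexOn_reaction (hf : ContDiff ℝ 2 f) (hf'' : ∀ u : ℝ, 0 < deriv (deriv f) u) :
    StrictConvexOn ℝ univ (reaction f um up) := by
  refine strictConvexOn_univ_of_deriv2_pos (continuous_reaction hf) fun x => ?_
  have h1 : deriv (reaction f um up) = fun v => deriv f v - speed f um up :=
    funext fun v => (hasDerivAt_reaction hf v).deriv
  simp only [Function.iterate_succ, Function.iterate_zero, Function.comp, id, h1]
  rw [deriv_sub_const]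
  exact hf'' x

theorem reaction_neg (hf : ContDiff ℝ 2 f) (hf'' : ∀ u : ℝ, 0 < deriv (deriv f) u)
    {v : ℝ} (hv : v ∈ Ioo up um) : reaction f um up v < 0 := by
  have hu : up < um := hv.1.trans hv.2
  have hL : 0 < um - up := sub_pos.2 hu
  have h := (strictConvexOn_reaction (um := um) (up := up) hf hf'').2 (mem_univ up) (mem_univ um)
    hu.ne
    (show 0 < (um - v) / (um - up) from div_pos (sub_pos.2 hv.2) hL)
    (show 0 < (v - up) / (um - up) from div_pos (sub_pos.2 hv.1) hL) (by field_simp; ring)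
  have hx : ((um - v) / (um - up)) • up + ((v - up) / (um - up)) • um = v := by
    simp only [smul_eq_mul]; field_simp; ring
  rw [hx, reaction_left, reaction_right f hu] at h
  simpa using h

/-- The concave function -g lies above its chord from `up` to `m`. -/
theorem exists_mul_le_neg_reaction (hf : ContDiff ℝ 2 f) (hf'' : ∀ u : ℝ, 0 < deriv (deriv f) u)
    (hu : up < um) :
    ∃ k > 0, ∃ m ∈ Ioo up um, ∀ v ∈ Icc up m, k * (v - up) ≤ -reaction f um up v := by
  obtain ⟨m, hm⟩ := exists_between hu
  have hL : 0 < m - up := sub_pos.2 hm.1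
  refine ⟨-reaction f um up m / (m - up), div_pos (neg_pos.2 (reaction_neg hf hf'' hm)) hL, m, hm,
    fun v hv => ?_⟩
  have h := (strictConvexOn_reaction (um := um) (up := up) hf hf'').convexOn.2
    (mem_univ up) (mem_univ m)
    (show 0 ≤ (m - v) / (m - up) from div_nonneg (sub_nonneg.2 hv.2) hL.le)
    (show 0 ≤ (v - up) / (m - up) from div_nonneg (sub_nonneg.2 hv.1) hL.le)
    (by field_simp; ring)
  have hx : ((m - v) / (m - up)) • up + ((v - up) / (m - up)) • m = v := by
    simp only [smul_eq_mul]; field_simp; ring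
  rw [hx, reaction_right f hu] at h
  simp only [smul_eq_mul, mul_zero, zero_add] at h
  have : -reaction f um up m / (m - up) * (v - up) =
    -((v - up) / (m - up) * reaction f um up m) := by ring
  linarith

theorem exists_neg_reaction_le (hf : ContDiff ℝ 2 f) (hu : up < um) :
    ∃ c > 0, ∀ v ∈ Icc up um,
      -reaction f um up v ≤ c * (v - up) ∧ -reaction f um up v ≤ c * (um - v) := by
  obtain ⟨C, hC⟩ := isCompact_Icc.exists_bound_of_continuousOn (s := Icc up um)
    (f := fun v => deriv f v - speed f um up)
    (((contDiff_deriv hf).continuous.sub continuous_const).continuousOn)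
  have key : ∀ x ∈ Icc up um, ∀ y ∈ Icc up um,
      |reaction f um up y - reaction f um up x| ≤ C * |y - x| := fun x hx y hy =>
    Convex.norm_image_sub_le_of_norm_hasDerivWithin_le
      (fun v _ => (hasDerivAt_reaction hf v).hasDerivWithinAt) hC (convex_Icc _ _) hx hy
  have hup : up ∈ Icc up um := ⟨le_rfl, hu.le⟩
  have hum : um ∈ Icc up um := ⟨hu.le, le_rfl⟩
  refine ⟨max C 1, lt_max_of_lt_right one_pos, fun v hv => ⟨?_, ?_⟩⟩
  · have h := key up hup v hv
    rw [reaction_right f hu, sub_zero, abs_of_nonneg (sub_nonneg.2 hv.1)] at h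
    exact (neg_le_abs _).trans (h.trans
      (mul_le_mul_of_nonneg_right (le_max_left _ _) (sub_nonneg.2 hv.1)))
  · have h := key v hv um hum
    rw [reaction_left, zero_sub, abs_neg, abs_of_nonneg (sub_nonneg.2 hv.2)] at h
    exact (neg_le_abs _).trans (h.trans
      (mul_le_mul_of_nonneg_right (le_max_left _ _) (sub_nonneg.2 hv.2)))

/-- The hump `-g` has a nondegenerate maximum in the interior. -/
theorem exists_isMax_neg_reaction (hf : ContDiff ℝ 2 f) (hf'' : ∀ u : ℝ, 0 < deriv (deriv f) u)
    (hu : up < um) :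
    ∃ vm ∈ Ioo up um, ∃ a > 0, ∀ v ∈ Icc up um,
      -reaction f um up v ≤ -reaction f um up vm - a * (v - vm) ^ 2 := by
  have hne : (Icc up um).Nonempty := nonempty_Icc.2 hu.le
  obtain ⟨vm, hvm, hmin⟩ := isCompact_Icc.exists_isMinOn hne
    (continuous_reaction (um := um) (up := up) hf).continuousOn
  obtain ⟨m, hm⟩ := exists_between hu
  have hneg : reaction f um up vm < 0 :=
    (hmin (Ioo_subset_Icc_self hm)).trans_lt (reaction_neg hf hf'' hm)
  have hvm' : vm ∈ Ioo up um := by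
    refine ⟨lt_of_le_of_ne hvm.1 fun h => ?_, lt_of_le_of_ne hvm.2 fun h => ?_⟩
    · rw [← h, reaction_right f hu] at hneg; exact lt_irrefl _ hneg
    · rw [h, reaction_left] at hneg; exact lt_irrefl _ hneg
  have hcrit : deriv f vm - speed f um up = 0 :=
    (hmin.isLocalMin (Icc_mem_nhds hvm'.1 hvm'.2)).hasDerivAt_eq_zero (hasDerivAt_reaction hf vm)
  have hf1 := contDiff_deriv hf
  obtain ⟨x, hx, hxmin⟩ := isCompact_Icc.exists_isMinOn hne
    (hf1.continuous_deriv le_rfl).continuousOn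
  -- With 2a = min f'' on the interval, f' - 2a·id is monotone. As g' vanishes at `vm`, the
  -- derivative of g - a(v - vm)² then has the sign of v - vm.
  set a := deriv (deriv f) x / 2 with ha
  have ha0 : 0 < a := half_pos (hf'' x)
  have hd1 : ∀ v, HasDerivAt (fun v => deriv f v - 2 * a * v) (deriv (deriv f) v - 2 * a) v :=
    fun v => by
      refine (((hf1.differentiable (by norm_num)) v).hasDerivAt.fun_sub
        ((hasDerivAt_id' v).const_mul (2 * a))).congr_deriv (by ring)
  have hmono : MonotoneOn (fun v => deriv f v - 2 * a * v) (Icc up um) := by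
    refine monotoneOn_of_deriv_nonneg (convex_Icc _ _)
      (fun v _ => (hd1 v).continuousAt.continuousWithinAt)
      (fun v _ => (hd1 v).differentiableAt.differentiableWithinAt) fun v hv => ?_
    rw [(hd1 v).deriv]
    have : deriv (deriv f) x ≤ deriv (deriv f) v := hxmin (interior_subset hv)
    linarith
  have hd2 : ∀ v, HasDerivAt (fun v => reaction f um up v - a * (v - vm) ^ 2)
      (deriv f v - speed f um up - 2 * a * (v - vm)) v := fun v => by
    refine ((hasDerivAt_reaction hf v).fun_sub
      ((((hasDerivAt_id' v).sub_const vm).fun_pow 2).const_mul a)).congr_deriv (by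
        simp; ring)
  have hc2 : Continuous (fun v => reaction f um up v - a * (v - vm) ^ 2) :=
    continuous_iff_continuousAt.2 fun v => (hd2 v).continuousAt
  refine ⟨vm, hvm', a, ha0, fun v hv => ?_⟩
  suffices h : reaction f um up vm - a * (vm - vm) ^ 2 ≤ reaction f um up v - a * (v - vm) ^ 2 by
    simp at h; linarith
  rcases le_total v vm with h | h
  · have : AntitoneOn (fun v => reaction f um up v - a * (v - vm) ^ 2) (Icc up vm) := by
      refine antitoneOn_of_deriv_nonpos (convex_Icc _ _) hc2.continuousOn
        (fun s _ => (hd2 s).differentiableAt.differentiableWithinAt) fun s hs => ?_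
      rw [interior_Icc] at hs
      rw [(hd2 s).deriv]
      have := hmono ⟨hs.1.le, hs.2.le.trans hvm.2⟩ hvm hs.2.le
      simp only at this
      linarith
    exact this ⟨hv.1, h⟩ ⟨hvm.1, le_rfl⟩ h
  · have : MonotoneOn (fun v => reaction f um up v - a * (v - vm) ^ 2) (Icc vm um) := by
      refine monotoneOn_of_deriv_nonneg (convex_Icc _ _) hc2.continuousOn
        (fun s _ => (hd2 s).differentiableAt.differentiableWithinAt) fun s hs => ?_
      rw [interior_Icc] at hs
      rw [(hd2 s).deriv]
      have := hmono hvm ⟨hvm.1.trans hs.1.le, hs.2.le⟩ hs.1.le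
      simp only at this
      linarith
    exact this ⟨le_rfl, hvm.2⟩ ⟨h, hv.2⟩ h

end

/-! ### From a slope function to a front -/

section

/-- Separation of variables: a slope function `p` which is positive inside `(up, um)` and vanishes
at least linearly at the end points is the slope of a decreasing front. -/
theorem exists_isDecreasingFront {um up C : ℝ} {p : ℝ → ℝ} (hu : up < um) (hC : 0 < C)
    (hpc : ContinuousOn p (Ioo up um)) (hpos : ∀ v ∈ Ioo up um, 0 < p v)
    (hb : ∀ v ∈ Ioo up um, p v ≤ C * (v - up) ∧ p v ≤ C * (um - v)) :
    ∃ v : ℝ → ℝ, IsDecreasingFront um up v ∧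
      ∀ ζ, v ζ ∈ Ioo up um ∧ HasDerivAt v (-p (v ζ)) ζ := by
  obtain ⟨m, hm⟩ := exists_between hu
  have hm : m ∈ Ioo up um := hm
  have hq : ContinuousOn (fun s => (p s)⁻¹) (Ioo up um) := hpc.inv₀ fun s hs => (hpos s hs).ne'
  -- The front is the inverse of -T. The linear bounds on `p` make T diverge at least
  -- logarithmically at both end points, so the profile is defined on all of ℝ.
  set T : ℝ → ℝ := fun x => ∫ s in m..x, (p s)⁻¹ with hT
  have hTd : ∀ x ∈ Ioo up um, HasDerivAt T (p x)⁻¹ x := fun x hx =>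
    intervalIntegral.integral_hasDerivAt_right
      ((hq.mono (ordConnected_Ioo.uIcc_subset hm hx)).intervalIntegrable)
      (hq.stronglyMeasurableAtFilter isOpen_Ioo x hx) (hq.continuousAt (Ioo_mem_nhds hx.1 hx.2))
  have hTm : T m = 0 := by simp [hT]
  have hTc : ContinuousOn T (Ioo up um) := fun x hx => (hTd x hx).continuousAt.continuousWithinAt
  have hTmono : StrictMonoOn T (Ioo up um) := by
    refine strictMonoOn_of_deriv_pos (convex_Ioo _ _) hTc fun x hx => ?_
    rw [interior_Ioo] at hx
    rw [(hTd x hx).deriv]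
    exact inv_pos.2 (hpos x hx)
  have hright : MonotoneOn (fun x => T x + C⁻¹ * Real.log (um - x)) (Ioo up um) := by
    have hd : ∀ x ∈ Ioo up um, HasDerivAt (fun x => T x + C⁻¹ * Real.log (um - x))
        ((p x)⁻¹ - (C * (um - x))⁻¹) x := fun x hx => by
      have h1 : um - x ≠ 0 := (sub_pos.2 hx.2).ne'
      refine ((hTd x hx).fun_add
        ((((hasDerivAt_id' x).const_sub um).log h1).const_mul C⁻¹)).congr_deriv ?_
      field_simp
      ring
    refine monotoneOn_of_deriv_nonneg (convex_Ioo _ _)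
      (fun x hx => (hd x hx).continuousAt.continuousWithinAt)
      (fun x hx => (hd x (interior_subset hx)).differentiableAt.differentiableWithinAt)
      fun x hx => ?_
    rw [interior_Ioo] at hx
    rw [(hd x hx).deriv, sub_nonneg]
    exact inv_anti₀ (hpos x hx) (hb x hx).2
  have hleft : MonotoneOn (fun x => T x - C⁻¹ * Real.log (x - up)) (Ioo up um) := by
    have hd : ∀ x ∈ Ioo up um, HasDerivAt (fun x => T x - C⁻¹ * Real.log (x - up))
        ((p x)⁻¹ - (C * (x - up))⁻¹) x := fun x hx => by
      have h1 : x - up ≠ 0 := (sub_pos.2 hx.1).ne'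
      refine ((hTd x hx).fun_sub
        ((((hasDerivAt_id' x).sub_const up).log h1).const_mul C⁻¹)).congr_deriv ?_
      field_simp
    refine monotoneOn_of_deriv_nonneg (convex_Ioo _ _)
      (fun x hx => (hd x hx).continuousAt.continuousWithinAt)
      (fun x hx => (hd x (interior_subset hx)).differentiableAt.differentiableWithinAt)
      fun x hx => ?_
    rw [interior_Ioo] at hx
    rw [(hd x hx).deriv, sub_nonneg]
    exact inv_anti₀ (hpos x hx) (hb x hx).1
  have hsurj : ∀ ζ : ℝ, ∃ x ∈ Ioo up um, T x = -ζ := by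
    intro ζ
    -- At distances (um - m)E and (m - up)E from the end points the logarithmic bounds on T are
    -- exactly |ζ| and -|ζ|.
    set E := Real.exp (-(C * |ζ|)) with hE
    have hE0 : 0 < E := Real.exp_pos _
    have hE1 : E ≤ 1 := Real.exp_le_one_iff.2 (neg_nonpos.2 (by positivity))
    have hlogE : Real.log E = -(C * |ζ|) := Real.log_exp _
    have hmr : 0 < um - m := sub_pos.2 hm.2
    have hml : 0 < m - up := sub_pos.2 hm.1
    set x := um - (um - m) * E with hx
    set y := up + (m - up) * E with hy
    have hxm : m ≤ x := by nlinarith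
    have hym : y ≤ m := by nlinarith
    have hxI : x ∈ Ioo up um := ⟨hm.1.trans_le hxm, by nlinarith [mul_pos hmr hE0]⟩
    have hyI : y ∈ Ioo up um := ⟨by nlinarith [mul_pos hml hE0], hym.trans_lt hm.2⟩
    have h1 := hright hm hxI hxm
    have h2 := hleft hyI hm hym
    have e1 : um - x = (um - m) * E := by rw [hx]; ring
    have e2 : y - up = (m - up) * E := by rw [hy]; ring
    have e3 : C⁻¹ * (C * |ζ|) = |ζ| := inv_mul_cancel_left₀ hC.ne' _
    simp only [hTm, e1, e2, Real.log_mul hmr.ne' hE0.ne', Real.log_mul hml.ne' hE0.ne', hlogE,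
      mul_add, mul_neg, e3] at h1 h2
    have h3 : -ζ ∈ Icc (T y) (T x) :=
      ⟨by linarith [le_abs_self ζ], by linarith [neg_le_abs ζ]⟩
    obtain ⟨z, hz, hz'⟩ := intermediate_value_Icc (hym.trans hxm)
      (hTc.mono (ordConnected_Ioo.out hyI hxI)) h3
    exact ⟨z, ordConnected_Ioo.out hyI hxI hz, hz'⟩
  choose v hvI hvT using hsurj
  have hanti : StrictAnti v := fun a b hab => by
    rw [← hTmono.lt_iff_lt (hvI b) (hvI a), hvT, hvT]
    exact neg_lt_neg hab
  have hrange : range v = Ioo up um := by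
    refine Subset.antisymm (range_subset_iff.2 hvI) fun x hx => ⟨-T x, ?_⟩
    exact hTmono.injOn (hvI _) hx (by rw [hvT, neg_neg])
  have hcont : ∀ ζ, ContinuousAt v ζ := fun ζ => by
    have : ContinuousAt (fun ζ => -v ζ) ζ := by
      refine continuousAt_of_monotoneOn_of_image_mem_nhds (s := univ)
        (hanti.antitone.neg.monotoneOn _) univ_mem ?_
      have : (fun ζ => -v ζ) '' univ = Neg.neg '' (Ioo up um) := by
        rw [← hrange, image_univ, ← range_comp]; rfl
      rw [this, image_neg_Ioo]
      exact Ioo_mem_nhds (neg_lt_neg (hvI ζ).2) (neg_lt_neg (hvI ζ).1)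
    simpa only [neg_neg] using this.fun_neg
  have hder : ∀ ζ, HasDerivAt v (-p (v ζ)) ζ := fun ζ => by
    have h1 : HasDerivAt (fun x => -T x) (-(p (v ζ))⁻¹) (v ζ) := (hTd _ (hvI ζ)).fun_neg
    have h2 := h1.of_local_left_inverse (hcont ζ)
      (neg_ne_zero.2 (inv_pos.2 (hpos _ (hvI ζ))).ne')
      (Eventually.of_forall fun y => by simp [hvT])
    refine h2.congr_deriv ?_
    rw [inv_neg, inv_inv]
  have hbot : Tendsto v atBot (𝓝 um) :=
    tendsto_atBot_isLUB hanti.antitone (by rw [hrange]; exact isLUB_Ioo hu)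
  have htop : Tendsto v atTop (𝓝 up) :=
    tendsto_atTop_isGLB hanti.antitone (by rw [hrange]; exact isGLB_Ioo hu)
  have hdv : deriv v = fun ζ => -p (v ζ) := funext fun ζ => (hder ζ).deriv
  refine ⟨v, ⟨hanti, hbot, htop, ?_, ?_⟩, fun ζ => ⟨hvI ζ, hder ζ⟩⟩
  · rw [hdv, ← neg_zero]
    refine (squeeze_zero (fun ζ => (hpos _ (hvI ζ)).le) (fun ζ => (hb _ (hvI ζ)).2) ?_).neg
    simpa using (hbot.const_sub um).const_mul C
  · rw [hdv, ← neg_zero]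
    refine (squeeze_zero (fun ζ => (hpos _ (hvI ζ)).le) (fun ζ => (hb _ (hvI ζ)).1) ?_).neg
    simpa using (htop.sub_const up).const_mul C

end

/-! ### Waves correspond to squared slopes vanishing at both ends -/

section

variable {f : ℝ → ℝ} {um up α δ ε : ℝ} {v w : ℝ → ℝ}

theorem IsDecreasingFront.mem_Ioo (h : IsDecreasingFront um up v) (ζ : ℝ) : v ζ ∈ Ioo up um :=
  ⟨(h.strictAnti.antitone.le_of_tendsto h.tendsto_atTop (ζ + 1)).trans_lt
      (h.strictAnti (lt_add_one ζ)),
    (h.strictAnti (sub_one_lt ζ)).trans_le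
      (h.strictAnti.antitone.ge_of_tendsto h.tendsto_atBot (ζ - 1))⟩

theorem IsDecreasingFront.deriv_nonpos (h : IsDecreasingFront um up v) (ζ : ℝ) : deriv v ζ ≤ 0 :=
  h.strictAnti.antitone.deriv_nonpos

theorem IsDecreasingFront.exists_eq (h : IsDecreasingFront um up v) (hv : Continuous v) {x : ℝ}
    (hx : x ∈ Ioo up um) : ∃ ζ, v ζ = x := by
  obtain ⟨a, ha⟩ := (h.tendsto_atTop.eventually_lt_const hx.1).exists
  obtain ⟨b, hb⟩ := (h.tendsto_atBot.eventually_const_lt hx.2).exists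
  exact mem_range_of_exists_le_of_exists_ge hv ⟨a, ha.le⟩ ⟨b, hb.le⟩

theorem IsMonotoneWave.hasDerivAt (h : IsMonotoneWave f um up α δ ε v) (ζ : ℝ) :
    HasDerivAt v (deriv v ζ) ζ :=
  ((h.contDiff.differentiable (by norm_num)) ζ).hasDerivAt

theorem IsMonotoneWave.hasDerivAt_deriv (h : IsMonotoneWave f um up α δ ε v) (ζ : ℝ) :
    HasDerivAt (deriv v) (deriv (deriv v) ζ) ζ :=
  (((contDiff_deriv h.contDiff).differentiable (by norm_num)) ζ).hasDerivAt

/-- If the squared slope vanishes at the far end, it is the squared slope of a wave. -/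
theorem IsSlopeSq.exists_isMonotoneWave (hf : ContDiff ℝ 2 f)
    (hf'' : ∀ u : ℝ, 0 < deriv (deriv f) u) (hu : up < um) (hα : 1 / 2 < α) (hδ : 0 < δ)
    (hε : 0 < ε)
    (H : IsSlopeSq α 0 (2 / δ) (2 * ε / δ) (um - up) (fun t => -reaction f um up (um - t)) w)
    (hw : w (um - up) = 0) : ∃ v, IsMonotoneWave f um up α δ ε v := by
  have hA : 0 < 2 / δ := by positivity
  have hB : 0 < 2 * ε / δ := by positivity
  have hG : ∀ t ∈ Ioo 0 (um - up), 0 < -reaction f um up (um - t) := fun t ht =>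
    neg_pos.2 (reaction_neg hf hf'' ⟨by linarith [ht.2], by linarith [ht.1]⟩)
  have hpos := H.pos hA hG
  obtain ⟨c, hc, hcb⟩ := exists_neg_reaction_le hf hu
  -- Dropping the flux gives w' ≤ (2/δ)ct, hence √w is at most linear at t = 0.
  have hnear : ∀ t ∈ Icc 0 (um - up), w t ≤ c / δ * t ^ 2 := by
    refine H.le_of_supersolution hα hB.le le_rfl le_rfl
      (z' := fun t => c / δ * (2 * t)) (by fun_prop)
      (fun t _ => ((hasDerivAt_pow 2 t).const_mul (c / δ)).congr_deriv (by simp))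
      (by simp [H.zero]) fun t ht => ?_
    have h1 := (hcb (um - t) ⟨by linarith [ht.2], by linarith [ht.1]⟩).2
    have h2 := mul_nonneg hB.le (sqFlux_nonneg α 0 (c / δ * t ^ 2))
    have h3 : 2 / δ * -reaction f um up (um - t) ≤ 2 / δ * (c * (um - (um - t))) :=
      mul_le_mul_of_nonneg_left h1 hA.le
    have h4 : 2 / δ * (c * (um - (um - t))) = c / δ * (2 * t) := by ring
    linarith
  -- From Φ(s) ≤ s and G > 0, √w decreases at rate at most ε/δ; since w vanishes at the far end, √w
  -- ≤ (ε/δ)(L - t).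
  have hfar : MonotoneOn (fun t => √(w t) + ε / δ * t) (Icc 0 (um - up)) := by
    have hd : ∀ t ∈ Ioo 0 (um - up), HasDerivAt (fun t => √(w t) + ε / δ * t)
        ((2 / δ * -reaction f um up (um - t) - 2 * ε / δ * sqFlux α 0 (w t)) / (2 * √(w t)) +
          ε / δ) t := fun t ht => by
      refine (((H.hasDerivAt t ht).sqrt (hpos t ht).ne').fun_add
        ((hasDerivAt_id' t).const_mul (ε / δ))).congr_deriv (by ring)
    refine monotoneOn_of_deriv_nonneg (convex_Icc _ _)
      ((H.continuousOn.sqrt).add (by fun_prop))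
      (fun t ht => (hd t (by rwa [interior_Icc] at ht)).differentiableAt.differentiableWithinAt)
      fun t ht => ?_
    rw [interior_Icc] at ht
    rw [(hd t ht).deriv, sqFlux_zero_of_nonneg α (hpos t ht).le]
    have hs : 0 < √(w t) := Real.sqrt_pos.2 (hpos t ht)
    have h1 := mul_pos hA (hG t ht)
    have h2 : 2 * ε / δ * flux α √(w t) ≤ 2 * ε / δ * √(w t) :=
      mul_le_mul_of_nonneg_left (flux_le_self hα hs.le) hB.le
    have h3 : -(ε / δ) ≤ (2 / δ * -reaction f um up (um - t) - 2 * ε / δ * flux α √(w t)) /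
        (2 * √(w t)) := by
      rw [le_div_iff₀ (by positivity)]
      have : -(ε / δ) * (2 * √(w t)) = -(2 * ε / δ * √(w t)) := by ring
      linarith
    linarith
  set p : ℝ → ℝ := fun x => √(w (um - x)) with hp
  have hmaps : MapsTo (fun x => um - x) (Ioo up um) (Ioo 0 (um - up)) := fun x hx =>
    ⟨by linarith [hx.2], by linarith [hx.1]⟩
  have hpc : ContinuousOn p (Ioo up um) :=
    ((H.continuousOn.mono Ioo_subset_Icc_self).comp (by fun_prop) hmaps).sqrt
  have hL : 0 ≤ um - up := by linarith
  obtain ⟨v, hv, hv'⟩ := exists_isDecreasingFront (p := p) (C := √(c / δ) + ε / δ) hu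
    (by positivity) hpc (fun x hx => Real.sqrt_pos.2 (hpos _ (hmaps hx))) (fun x hx => by
      have hx1 : 0 ≤ x - up := by linarith [hx.1]
      have hx2 : 0 ≤ um - x := by linarith [hx.2]
      constructor
      · have h1 := hfar (Ioo_subset_Icc_self (hmaps hx)) ⟨hL, le_rfl⟩ (hmaps hx).2.le
        simp only [hw, Real.sqrt_zero] at h1
        have h2 : 0 ≤ √(c / δ) * (x - up) := by positivity
        simp only [hp]
        nlinarith
      · have h1 := Real.sqrt_le_sqrt (hnear _ (Ioo_subset_Icc_self (hmaps hx)))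
        rw [Real.sqrt_mul (by positivity), Real.sqrt_sq hx2] at h1
        have h2 : 0 ≤ ε / δ * (um - x) := by positivity
        simp only [hp]
        linarith)
  have hdv : deriv v = fun ζ => -√(w (um - v ζ)) := funext fun ζ => (hv' ζ).2.deriv
  have hddv : ∀ ζ, HasDerivAt (deriv v)
      ((reaction f um up (v ζ) - ε * flux α (deriv v ζ)) / δ) ζ := fun ζ => by
    have hI := hmaps (hv' ζ).1
    have h1 : HasDerivAt (fun ζ => w (um - v ζ)) _ ζ :=
      (H.hasDerivAt _ hI).comp ζ ((hv' ζ).2.const_sub um)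
    have hs : 0 < √(w (um - v ζ)) := Real.sqrt_pos.2 (hpos _ hI)
    rw [hdv]
    refine (h1.sqrt (hpos _ hI).ne').fun_neg.congr_deriv ?_
    rw [sqFlux_zero_of_nonneg α (hpos _ hI).le, sub_sub_cancel, flux_neg]
    simp only [hp]
    field_simp
    ring
  have hvc : Continuous v := continuous_iff_continuousAt.2 fun ζ => (hv' ζ).2.continuousAt
  have hdvc : Continuous (deriv v) := continuous_iff_continuousAt.2 fun ζ => (hddv ζ).continuousAt
  refine ⟨v, ?_, hv, fun ζ => ?_⟩
  · have : ContDiff ℝ (1 + 1) v := by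
      rw [contDiff_succ_iff_deriv]
      refine ⟨fun ζ => (hv' ζ).2.differentiableAt, by simp, ?_⟩
      rw [contDiff_one_iff_deriv]
      refine ⟨fun ζ => (hddv ζ).differentiableAt, ?_⟩
      rw [show deriv (deriv v) = _ from funext fun ζ => (hddv ζ).deriv]
      exact (((continuous_reaction hf).comp hvc).sub
        (continuous_const.mul ((continuous_flux α).comp hdvc))).div_const δ
    simpa [one_add_one_eq_two] using this
  · rw [(hddv ζ).deriv, mul_div_cancel₀ _ hδ.ne']
    ring

/-- The squared slope of a wave is the solution of the initial value problem. -/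
theorem IsMonotoneWave.slopeSq_eq_zero (hα : 1 / 2 < α) (hδ : 0 < δ) (hε : 0 ≤ ε)
    (hv : IsMonotoneWave f um up α δ ε v)
    (H : IsSlopeSq α 0 (2 / δ) (2 * ε / δ) (um - up) (fun t => -reaction f um up (um - t)) w) :
    w (um - up) = 0 := by
  have hmem : ∀ ζ, um - v ζ ∈ Ioo 0 (um - up) := fun ζ =>
    ⟨by linarith [(hv.front.mem_Ioo ζ).2], by linarith [(hv.front.mem_Ioo ζ).1]⟩
  have hmem' : ∀ ζ, um - v ζ ∈ Icc 0 (um - up) := fun ζ => Ioo_subset_Icc_self (hmem ζ)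
  have hL : 0 ≤ um - up := (hmem' 0).1.trans (hmem' 0).2
  have hB : 0 ≤ 2 * ε / δ := by positivity
  set B := 2 * ε / δ with hBdef
  have hwlim : ∀ {l : Filter ℝ} {x : ℝ}, um - x ∈ Icc 0 (um - up) → Tendsto v l (𝓝 x) →
      Tendsto (fun ζ => w (um - v ζ)) l (𝓝 (w (um - x))) := fun hx hl =>
    (H.continuousOn _ hx).tendsto.comp (tendsto_nhdsWithin_iff.2
      ⟨hl.const_sub um, Eventually.of_forall hmem'⟩)
  set D : ℝ → ℝ := fun ζ => deriv v ζ ^ 2 - w (um - v ζ) with hD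
  have hD' : ∀ ζ, HasDerivAt D (deriv v ζ *
      (B * (sqFlux α 0 (deriv v ζ ^ 2) - sqFlux α 0 (w (um - v ζ))))) ζ := fun ζ => by
    have h1 : HasDerivAt (fun ζ => w (um - v ζ)) _ ζ :=
      (H.hasDerivAt _ (hmem ζ)).comp ζ ((hv.hasDerivAt ζ).const_sub um)
    refine (((hv.hasDerivAt_deriv ζ).fun_pow 2).fun_sub h1).congr_deriv ?_
    have h2 : sqFlux α 0 (deriv v ζ ^ 2) = -flux α (deriv v ζ) := by
      rw [sqFlux_zero_of_nonneg α (sq_nonneg _), Real.sqrt_sq_eq_abs,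
        abs_of_nonpos (hv.front.deriv_nonpos ζ), flux_neg]
    have h3 : deriv (deriv v) ζ = (reaction f um up (v ζ) - ε * flux α (deriv v ζ)) / δ := by
      rw [eq_div_iff hδ.ne']; linarith [hv.equation ζ]
    rw [h2, h3, hBdef, sub_sub_cancel]
    field_simp
    ring
  -- Uniqueness is proved in ζ, since v' is not known to be nonzero and w is singular at its zeros.
  -- The weight exp(κv) absorbs the one-sided Lipschitz constant: as v' ≤ 0, D² exp(κv) is
  -- nonincreasing; it tends to 0 at -∞ and hence vanishes.
  set κ := 2 * (B * (2 * α)) with hκ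
  have hQ' : ∀ ζ, HasDerivAt (fun ζ => D ζ ^ 2 * Real.exp (κ * v ζ))
      (deriv v ζ * Real.exp (κ * v ζ) * (2 * B * ((sqFlux α 0 (deriv v ζ ^ 2) -
        sqFlux α 0 (w (um - v ζ))) * D ζ + 2 * α * D ζ ^ 2))) ζ := fun ζ => by
    refine (((hD' ζ).fun_pow 2).fun_mul
      ((hv.hasDerivAt ζ).const_mul κ).exp).congr_deriv ?_
    rw [hκ]
    norm_num
    ring
  have hone : ∀ x y : ℝ, 0 ≤ (sqFlux α 0 x - sqFlux α 0 y) * (x - y) + 2 * α * (x - y) ^ 2 := by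
    intro x y
    rcases le_total y x with h | h
    · nlinarith [sqFlux_sub_le hα le_rfl h]
    · nlinarith [sqFlux_sub_le hα le_rfl h]
  have hanti : Antitone fun ζ => D ζ ^ 2 * Real.exp (κ * v ζ) := by
    refine antitone_of_deriv_nonpos (fun ζ => (hQ' ζ).differentiableAt) fun ζ => ?_
    rw [(hQ' ζ).deriv]
    refine mul_nonpos_of_nonpos_of_nonneg (mul_nonpos_of_nonpos_of_nonneg
      (hv.front.deriv_nonpos ζ) (Real.exp_pos _).le) ?_
    exact mul_nonneg (by linarith) (hone _ _)
  have hlim : Tendsto (fun ζ => D ζ ^ 2 * Real.exp (κ * v ζ)) atBot (𝓝 0) := by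
    have h1 : Tendsto D atBot (𝓝 0) := by
      have := (hv.front.deriv_tendsto_atBot.pow 2).sub
        (hwlim (by simpa using hL) hv.front.tendsto_atBot)
      simpa [H.zero] using this
    have h2 : Tendsto (fun ζ => Real.exp (κ * v ζ)) atBot (𝓝 (Real.exp (κ * um))) :=
      (Real.continuous_exp.tendsto _).comp (hv.front.tendsto_atBot.const_mul κ)
    simpa using (h1.pow 2).mul h2
  have hD0 : ∀ ζ, w (um - v ζ) = deriv v ζ ^ 2 := fun ζ => by
    have h1 := hanti.ge_of_tendsto hlim ζ
    have h2 : D ζ ^ 2 = 0 := by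
      have := Real.exp_pos (κ * v ζ)
      nlinarith [sq_nonneg (D ζ), mul_nonneg (sq_nonneg (D ζ)) this.le]
    have h3 : D ζ = 0 := by simpa using h2
    simp only [hD] at h3
    linarith
  refine tendsto_nhds_unique (hwlim ⟨hL, le_rfl⟩ hv.front.tendsto_atTop) ?_
  simp only [hD0]
  simpa using hv.front.deriv_tendsto_atTop.pow 2

end

/-! ### The problem without dispersion -/

section

variable {f : ℝ → ℝ} {um up α δ ε : ℝ} {v w : ℝ → ℝ}

/-- The continuous inverse of the increasing branch of the flux. -/
theorem exists_flux_inverse (hα : 1 / 2 < α) : ∃ ψ : ℝ → ℝ, Continuous ψ ∧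
    ∀ y ∈ Icc 0 (flux α (critSlope α)), ψ y ∈ Icc 0 (critSlope α) ∧ flux α (ψ y) = y := by
  have hq := (critSlope_pos hα).le
  have hM := (flux_max_pos hα).le
  have himg : flux α '' Icc 0 (critSlope α) = Icc 0 (flux α (critSlope α)) := by
    have := (continuous_flux α).continuousOn.image_Icc_of_monotoneOn hq
      (strictMonoOn_flux hα).monotoneOn
    rwa [flux_zero] at this
  set e := ((strictMonoOn_flux hα).orderIso _ _).trans (OrderIso.setCongr _ _ himg) with he
  refine ⟨IccExtend hM fun y => (e.symm y : ℝ),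
    (continuous_subtype_val.comp e.symm.continuous).Icc_extend', fun y hy => ?_⟩
  rw [IccExtend_of_mem _ _ hy]
  refine ⟨(e.symm ⟨y, hy⟩).2, ?_⟩
  have h1 : (e (e.symm ⟨y, hy⟩) : ℝ) = y := by rw [e.apply_symm_apply]
  exact h1

/-- The slope Φ⁻¹(-g/ε), taken on the increasing branch, is continuous up to and including the
maximum of Φ. It is bounded by a multiple of -g, so it vanishes linearly at both ends as separation
of variables requires. -/
theorem exists_isReducedMonotoneWave (hf : ContDiff ℝ 2 f)
    (hf'' : ∀ u : ℝ, 0 < deriv (deriv f) u) (hu : up < um) (hα : 1 / 2 < α) (hε : 0 < ε)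
    (hmax : ∀ x ∈ Icc up um, -reaction f um up x ≤ ε * flux α (critSlope α)) :
    ∃ v, IsReducedMonotoneWave f um up α ε v := by
  obtain ⟨ψ, hψc, hψ⟩ := exists_flux_inverse hα
  obtain ⟨c, hc, hcb⟩ := exists_neg_reaction_le hf hu
  have hmem : ∀ x ∈ Ioo up um,
      -reaction f um up x / ε ∈ Icc 0 (flux α (critSlope α)) := fun x hx =>
    ⟨div_nonneg (neg_pos.2 (reaction_neg hf hf'' hx)).le hε.le,
      (div_le_iff₀' hε).2 (hmax x (Ioo_subset_Icc_self hx))⟩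
  set p : ℝ → ℝ := fun x => ψ (-reaction f um up x / ε) with hp
  have hpc : Continuous p := hψc.comp ((continuous_reaction hf).neg.div_const ε)
  have hflux : ∀ x ∈ Ioo up um, flux α (p x) = -reaction f um up x / ε := fun x hx =>
    (hψ _ (hmem x hx)).2
  have hp0 : ∀ x ∈ Ioo up um, 0 < p x := fun x hx => by
    refine lt_of_le_of_ne (hψ _ (hmem x hx)).1.1 fun h => ?_
    have h1 := hflux x hx
    rw [← h, flux_zero] at h1
    exact (div_pos (neg_pos.2 (reaction_neg hf hf'' hx)) hε).ne h1
  set r := (1 + critSlope α ^ 2) ^ (-α) with hr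
  have hr0 : 0 < r := by positivity
  have hple : ∀ x ∈ Ioo up um, p x ≤ (ε * r)⁻¹ * -reaction f um up x := fun x hx => by
    have h1 := mul_le_flux hα (hp0 x hx).le (hψ _ (hmem x hx)).1.2
    rw [← div_eq_inv_mul, le_div_iff₀ (by positivity)]
    rw [hflux x hx, le_div_iff₀ hε] at h1
    linarith
  obtain ⟨v, hv, hv'⟩ := exists_isDecreasingFront (p := p) (C := (ε * r)⁻¹ * c) hu
    (by positivity) hpc.continuousOn hp0 (fun x hx => by
      have h1 := hcb x (Ioo_subset_Icc_self hx)
      have h2 : 0 ≤ (ε * r)⁻¹ := by positivity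
      rw [mul_assoc, mul_assoc]
      exact ⟨(hple x hx).trans (mul_le_mul_of_nonneg_left h1.1 h2),
        (hple x hx).trans (mul_le_mul_of_nonneg_left h1.2 h2)⟩)
  have hdv : deriv v = fun ζ => -p (v ζ) := funext fun ζ => (hv' ζ).2.deriv
  have hvc : Continuous v := continuous_iff_continuousAt.2 fun ζ => (hv' ζ).2.continuousAt
  refine ⟨v, ?_, hv, fun ζ => ?_⟩
  · rw [contDiff_one_iff_deriv, hdv]
    exact ⟨fun ζ => (hv' ζ).2.differentiableAt, (hpc.comp hvc).neg⟩
  · rw [hdv]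
    simp only [flux_neg, hflux _ (hv' ζ).1]
    field_simp

/-- The minimal value of the reduced problem. -/
theorem isLeast_reducedWaveSet (hf : ContDiff ℝ 2 f)
    (hf'' : ∀ u : ℝ, 0 < deriv (deriv f) u) (hu : up < um) (hα : 1 / 2 < α) {vm : ℝ}
    (hvm : vm ∈ Ioo up um)
    (hmax : ∀ x ∈ Icc up um, -reaction f um up x ≤ -reaction f um up vm) :
    IsLeast (reducedWaveSet f um up α) (-reaction f um up vm / flux α (critSlope α)) := by
  have hM := flux_max_pos hα
  have h0 : 0 < -reaction f um up vm / flux α (critSlope α) :=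
    div_pos (neg_pos.2 (reaction_neg hf hf'' hvm)) hM
  refine ⟨⟨h0, exists_isReducedMonotoneWave hf hf'' hu hα h0 fun x hx => ?_⟩, ?_⟩
  · rw [div_mul_cancel₀ _ hM.ne']
    exact hmax x hx
  · rintro ε ⟨hε, v, hv⟩
    obtain ⟨ζ, hζ⟩ := hv.front.exists_eq hv.contDiff.continuous hvm
    rw [div_le_iff₀ hM]
    have h1 := hv.equation ζ
    rw [hζ] at h1
    have h2 := flux_le_max hα (neg_nonneg.2 (hv.front.deriv_nonpos ζ))
    rw [flux_neg] at h2
    nlinarith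

end

/-! ### Necessary conditions for waves: large and small dispersion -/

section

variable {f : ℝ → ℝ} {um up α δ ε : ℝ} {v w : ℝ → ℝ}

/-- A wave of the equation with dispersion `δ` needs dissipation of order at least `√δ`. -/
theorem exists_mul_le_sq_of_isMonotoneWave (hf : ContDiff ℝ 2 f)
    (hf'' : ∀ u : ℝ, 0 < deriv (deriv f) u) (hu : up < um) (hα : 1 / 2 < α) :
    ∃ k > 0, ∀ δ ε : ℝ, 0 < δ → 0 < ε → ∀ v, IsMonotoneWave f um up α δ ε v → k * δ ≤ ε ^ 2 := by
  obtain ⟨k, hk, m, hm, hkm⟩ := exists_mul_le_neg_reaction hf hf'' hu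
  refine ⟨k, hk, fun δ ε hδ hε v hv => ?_⟩
  have hflux : ∀ ζ, deriv v ζ ≤ flux α (deriv v ζ) := fun ζ => by
    have := flux_le_self hα (neg_nonneg.2 (hv.front.deriv_nonpos ζ))
    rw [flux_neg] at this
    linarith
  have hd : ∀ κ ζ, HasDerivAt (fun ζ => -(δ * deriv v ζ) - κ * v ζ)
      (-reaction f um up (v ζ) + ε * flux α (deriv v ζ) - κ * deriv v ζ) ζ := fun κ ζ => by
    refine (((hv.hasDerivAt_deriv ζ).const_mul δ).fun_neg.fun_sub
      ((hv.hasDerivAt ζ).const_mul κ)).congr_deriv ?_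
    linarith [hv.equation ζ]
  have hlim : ∀ κ, Tendsto (fun ζ => -(δ * deriv v ζ) - κ * v ζ) atTop (𝓝 (-(κ * up))) :=
    fun κ => by
      simpa using ((hv.front.deriv_tendsto_atTop.const_mul δ).neg).sub
        (hv.front.tendsto_atTop.const_mul κ)
  have h1 : ∀ ζ, -(δ * deriv v ζ) ≤ ε * (v ζ - up) := fun ζ => by
    have hmono : Monotone (fun ζ => -(δ * deriv v ζ) - ε * v ζ) := by
      refine monotone_of_deriv_nonneg (fun ζ => (hd ε ζ).differentiableAt) fun ζ => ?_
      rw [(hd ε ζ).deriv]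
      have h2 := reaction_neg hf hf'' (hv.front.mem_Ioo ζ)
      have h3 := mul_le_mul_of_nonneg_left (hflux ζ) hε.le
      linarith
    have := hmono.ge_of_tendsto (hlim ε) ζ
    linarith
  obtain ⟨ζ₀, hζ₀⟩ := hv.front.exists_eq hv.contDiff.continuous hm
  -- Near `up` the first bound δ|v'| ≤ ε(v - up) gives -g ≥ k(v - up) ≥ (kδ/ε)|v'|, which improves
  -- its constant from ε to κ = ε - kδ/ε. As the left side is nonnegative, κ ≥ 0.
  set κ := ε - k * δ / ε with hκ
  have hmono : MonotoneOn (fun ζ => -(δ * deriv v ζ) - κ * v ζ) (Ici ζ₀) := by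
    refine monotoneOn_of_deriv_nonneg (convex_Ici _)
      (fun ζ _ => (hd κ ζ).continuousAt.continuousWithinAt)
      (fun ζ _ => (hd κ ζ).differentiableAt.differentiableWithinAt) fun ζ hζ => ?_
    rw [interior_Ici] at hζ
    have hζ : ζ₀ < ζ := hζ
    rw [(hd κ ζ).deriv]
    have h2 := hkm (v ζ) ⟨(hv.front.mem_Ioo ζ).1.le, by
      rw [← hζ₀]; exact (hv.front.strictAnti hζ).le⟩
    have h3 := mul_le_mul_of_nonneg_left (hflux ζ) hε.le
    have h4 : k / ε * -(δ * deriv v ζ) ≤ k / ε * (ε * (v ζ - up)) :=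
      mul_le_mul_of_nonneg_left (h1 ζ) (by positivity)
    have h5 : k / ε * (ε * (v ζ - up)) = k * (v ζ - up) := by field_simp
    have h6 : κ * deriv v ζ = ε * deriv v ζ + k / ε * -(δ * deriv v ζ) := by rw [hκ]; ring
    linarith
  have h2 : -(δ * deriv v ζ₀) - κ * v ζ₀ ≤ -(κ * up) :=
    ge_of_tendsto (hlim κ) ((eventually_ge_atTop ζ₀).mono fun ζ hζ =>
      hmono self_mem_Ici hζ hζ)
  have h3 := mul_nonneg hδ.le (neg_nonneg.2 (hv.front.deriv_nonpos ζ₀))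
  have h4 : 0 < v ζ₀ - up := sub_pos.2 (hv.front.mem_Ioo ζ₀).1
  have h5 : 0 ≤ κ := by
    by_contra h
    nlinarith
  rw [hκ, sub_nonneg, div_le_iff₀ hε] at h5
  linarith

/-- The slope of a wave is bounded in terms of the dispersion. -/
theorem IsMonotoneWave.mul_slope_rpow_le (hf : ContDiff ℝ 2 f)
    (hf'' : ∀ u : ℝ, 0 < deriv (deriv f) u) (hα : 1 / 2 < α) (hε : 0 < ε)
    (hv : IsMonotoneWave f um up α δ ε v) (ζ : ℝ) :
    δ * (-deriv v ζ) ^ (2 * α + 1) ≤ (2 * α + 1) * (ε * (v ζ - up)) := by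
  have hd : ∀ ζ, HasDerivAt (fun ζ => δ * (-deriv v ζ) ^ (2 * α + 1) - (2 * α + 1) * (ε * v ζ))
      ((2 * α + 1) * ((-deriv v ζ) ^ (2 * α) *
        (-reaction f um up (v ζ) + ε * flux α (deriv v ζ)) - ε * deriv v ζ)) ζ := fun ζ => by
    refine ((((hv.hasDerivAt_deriv ζ).fun_neg.rpow_const (p := 2 * α + 1)
      (Or.inr (by linarith))).const_mul δ).fun_sub
      (((hv.hasDerivAt ζ).const_mul ε).const_mul (2 * α + 1))).congr_deriv ?_
    rw [add_sub_cancel_right]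
    have h1 := hv.equation ζ
    linear_combination ((2 * α + 1) * (-deriv v ζ) ^ (2 * α)) * h1
  have hmono : Monotone fun ζ =>
      δ * (-deriv v ζ) ^ (2 * α + 1) - (2 * α + 1) * (ε * v ζ) := by
    refine monotone_of_deriv_nonneg (fun ζ => (hd ζ).differentiableAt) fun ζ => ?_
    rw [(hd ζ).deriv]
    refine mul_nonneg (by linarith) ?_
    have hp : 0 ≤ -deriv v ζ := neg_nonneg.2 (hv.front.deriv_nonpos ζ)
    have h1 : flux α (deriv v ζ) = -flux α (-deriv v ζ) := by rw [flux_neg, neg_neg]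
    -- The exponent is chosen so that s^(2α) Φ(s) ≤ s: after multiplication by s^(2α) the
    -- dissipation is bounded by ε|v'|, which integrates to ε(v - up).
    have h2 : (-deriv v ζ) ^ (2 * α) * flux α (-deriv v ζ) ≤ -deriv v ζ := by
      rw [flux, mul_div_assoc', div_le_iff₀ (by positivity), mul_comm]
      refine mul_le_mul_of_nonneg_left ?_ hp
      rw [Real.rpow_mul hp, Real.rpow_two]
      exact Real.rpow_le_rpow (sq_nonneg _) (by linarith) (by linarith)
    have h3 := mul_nonneg (Real.rpow_nonneg hp (2 * α))
      (neg_pos.2 (reaction_neg hf hf'' (hv.front.mem_Ioo ζ))).le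
    rw [h1]
    nlinarith
  have hlim : Tendsto (fun ζ => δ * (-deriv v ζ) ^ (2 * α + 1) - (2 * α + 1) * (ε * v ζ)) atTop
      (𝓝 (-((2 * α + 1) * (ε * up)))) := by
    have h1 := hv.front.deriv_tendsto_atTop.neg.rpow_const (p := 2 * α + 1)
      (Or.inr (by linarith))
    rw [neg_zero, Real.zero_rpow (by linarith)] at h1
    simpa using (h1.const_mul δ).sub ((hv.front.tendsto_atTop.const_mul ε).const_mul (2 * α + 1))
  have := hmono.ge_of_tendsto hlim ζ
  linarith

/-- For small dispersion, waves need almost the dissipation of the reduced problem. -/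
theorem exists_forall_lt_of_isMonotoneWave (hf : ContDiff ℝ 2 f)
    (hf'' : ∀ u : ℝ, 0 < deriv (deriv f) u) (hα : 1 / 2 < α) {vm ε₁ : ℝ}
    (hvm : vm ∈ Ioo up um) (hε₁ : ε₁ * flux α (critSlope α) < -reaction f um up vm) :
    ∃ δ₁ > 0, ∀ δ ε : ℝ, 0 < δ → δ < δ₁ → 0 < ε → ∀ v, IsMonotoneWave f um up α δ ε v →
      ε₁ < ε := by
  have hM := flux_max_pos hα
  obtain ⟨η, hη, hη'⟩ : ∃ η > 0, ε₁ * flux α (critSlope α) + η < -reaction f um up vm :=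
    ⟨(-reaction f um up vm - ε₁ * flux α (critSlope α)) / 2, by linarith, by linarith⟩
  obtain ⟨x, hx, hxG⟩ : ∃ x ∈ Ioo up vm, ∀ y ∈ Icc x vm,
      ε₁ * flux α (critSlope α) + η < -reaction f um up y := by
    have h1 : ∀ᶠ y in 𝓝 vm, ε₁ * flux α (critSlope α) + η < -reaction f um up y :=
      (continuous_reaction hf).neg.continuousAt.eventually_const_lt hη'
    obtain ⟨r, hr, hball⟩ := Metric.eventually_nhds_iff.1 h1
    obtain ⟨x, hx1, hx2⟩ := exists_between (max_lt hvm.1 (sub_lt_self vm hr))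
    refine ⟨x, ⟨(le_max_left _ _).trans_lt hx1, hx2⟩, fun y hy => hball ?_⟩
    rw [Real.dist_eq, abs_lt]
    have := (le_max_right _ _).trans_lt hx1
    constructor <;> linarith [hy.1, hy.2]
  set ℓ := vm - x with hℓ
  have hℓ0 : 0 < ℓ := sub_pos.2 hx.2
  -- The excess η over length ℓ will force δp² ≥ 2ηℓ. Raised to the power α + 1/2 this reads c ≤
  -- δ^(α-1/2) · δp^(2α+1), and the last factor is bounded.
  set c := (2 * (η * ℓ)) ^ (α + 1 / 2) with hc
  have hc0 : 0 < c := by positivity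
  obtain ⟨δ₁, hδ₁, hsmall⟩ : ∃ δ₁ > 0, ∀ δ, 0 < δ → δ < δ₁ →
      (2 * α + 1) * (ε₁ * (um - up)) * δ ^ (α - 1 / 2) < c := by
    have h1 : Tendsto (fun δ : ℝ => (2 * α + 1) * (ε₁ * (um - up)) * δ ^ (α - 1 / 2)) (𝓝 0)
        (𝓝 0) := by
      have := (Real.continuousAt_rpow_const 0 (α - 1 / 2) (Or.inr (by linarith))).tendsto
      rw [Real.zero_rpow (by linarith)] at this
      simpa using this.const_mul ((2 * α + 1) * (ε₁ * (um - up)))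
    obtain ⟨r, hr, hball⟩ := Metric.eventually_nhds_iff.1 (h1.eventually_lt_const hc0)
    refine ⟨r, hr, fun δ h0 hδ => hball ?_⟩
    rwa [Real.dist_eq, sub_zero, abs_of_pos h0]
  refine ⟨δ₁, hδ₁, fun δ ε hδ hδδ₁ hε v hv => ?_⟩
  by_contra! hle
  have hxI : x ∈ Ioo up um := ⟨hx.1, hx.2.trans hvm.2⟩
  obtain ⟨ζm, hζm⟩ := hv.front.exists_eq hv.contDiff.continuous hvm
  obtain ⟨ζx, hζx⟩ := hv.front.exists_eq hv.contDiff.continuous hxI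
  have hζ : ζm < ζx := by
    rw [← hv.front.strictAnti.lt_iff_gt, hζm, hζx]; exact hx.2
  have hd : ∀ ζ, HasDerivAt (fun ζ => δ * deriv v ζ ^ 2 + 2 * η * v ζ)
      (2 * deriv v ζ * (reaction f um up (v ζ) - ε * flux α (deriv v ζ) + η)) ζ := fun ζ => by
    refine ((((hv.hasDerivAt_deriv ζ).fun_pow 2).const_mul δ).fun_add
      ((hv.hasDerivAt ζ).const_mul (2 * η))).congr_deriv ?_
    have h1 := hv.equation ζ
    norm_num
    linear_combination (-2 * deriv v ζ) * h1
  have hmono : MonotoneOn (fun ζ => δ * deriv v ζ ^ 2 + 2 * η * v ζ) (Icc ζm ζx) := by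
    refine monotoneOn_of_deriv_nonneg (convex_Icc _ _)
      (fun ζ _ => (hd ζ).continuousAt.continuousWithinAt)
      (fun ζ _ => (hd ζ).differentiableAt.differentiableWithinAt) fun ζ hζ => ?_
    rw [interior_Icc] at hζ
    rw [(hd ζ).deriv]
    have h1 := hxG (v ζ) ⟨by rw [← hζx]; exact (hv.front.strictAnti hζ.2).le,
      by rw [← hζm]; exact (hv.front.strictAnti hζ.1).le⟩
    have hp := hv.front.deriv_nonpos ζ
    have h2 := flux_le_max hα (neg_nonneg.2 hp)
    have h3 := flux_nonneg α (neg_nonneg.2 hp)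
    rw [flux_neg] at h2 h3
    have h4 : ε * -flux α (deriv v ζ) ≤ ε₁ * flux α (critSlope α) :=
      mul_le_mul hle h2 h3 (hε.le.trans hle)
    exact mul_nonneg_of_nonpos_of_nonpos (by linarith) (by linarith)
  have h1 := hmono ⟨le_rfl, hζ.le⟩ ⟨hζ.le, le_rfl⟩ hζ.le
  simp only [hζm, hζx] at h1
  have h2 := hv.mul_slope_rpow_le hf hf'' hα hε ζx
  set p := -deriv v ζx with hp
  have hp0 : 0 ≤ p := neg_nonneg.2 (hv.front.deriv_nonpos ζx)
  have h3 : 2 * (η * ℓ) ≤ δ * p ^ 2 := by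
    have : p ^ 2 = deriv v ζx ^ 2 := by rw [hp, neg_sq]
    nlinarith [mul_nonneg hδ.le (sq_nonneg (deriv v ζm))]
  have h4 : c ≤ δ ^ (α + 1 / 2) * p ^ (2 * α + 1) := by
    have h5 := Real.rpow_le_rpow (by positivity) h3 (show 0 ≤ α + 1 / 2 by linarith)
    rw [Real.mul_rpow hδ.le (sq_nonneg p), ← Real.rpow_two, ← Real.rpow_mul hp0] at h5
    rwa [show 2 * (α + 1 / 2) = 2 * α + 1 by ring] at h5
  have h5 : δ ^ (α + 1 / 2) = δ ^ (α - 1 / 2) * δ := by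
    rw [← Real.rpow_add_one hδ.ne']; ring_nf
  have h6 : (2 * α + 1) * (ε * (v ζx - up)) ≤ (2 * α + 1) * (ε₁ * (um - up)) := by
    refine mul_le_mul_of_nonneg_left (mul_le_mul hle ?_ ?_ (hε.le.trans hle)) (by linarith)
    · linarith [(hv.front.mem_Ioo ζx).2]
    · linarith [(hv.front.mem_Ioo ζx).1]
  have h7 := mul_le_mul_of_nonneg_left (h2.trans h6) (Real.rpow_nonneg hδ.le (α - 1 / 2))
  have h8 := hsmall δ hδ hδδ₁
  rw [h5, mul_assoc] at h4
  linarith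

end

/-! ### Connections: existence, compactness and the gain over the reduced problem -/

section

variable {f : ℝ → ℝ} {um up α δ ε : ℝ} {v w : ℝ → ℝ}

/-- A linear supersolution forces the squared slope to vanish at the far end. -/
theorem IsSlopeSq.nonpos_of_linear_bound (hα : 1 / 2 < α) {A B L a c m P : ℝ} {G : ℝ → ℝ}
    (H : IsSlopeSq α 0 A B L G w) (hA : 0 ≤ A) (hB : 0 ≤ B) (ha : 0 ≤ a) (haL : a ≤ L)
    (hm : 0 ≤ m) (hG : ∀ t ∈ Ioo 0 L, G t ≤ c * (L - t)) (hP : m * (L - a) ≤ P)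
    (hc : A * c + 2 * m ^ 2 ≤ B * (m * (1 + P ^ 2) ^ (-α)))
    (hwa : w a ≤ (m * (L - a)) ^ 2) : w L ≤ 0 := by
  -- For z = (m(L - t))² every term of the supersolution inequality carries a factor L - t, and `hc`
  -- is what remains after cancelling it.
  have key := H.le_of_supersolution hα hB ha le_rfl (z := fun t => (m * (L - t)) ^ 2)
    (z' := fun t => -(2 * m ^ 2 * (L - t))) (by fun_prop)
    (fun t _ => ((((hasDerivAt_id' t).const_sub L).const_mul m).fun_pow 2).congr_deriv
      (by norm_num; ring)) hwa (fun t ht => by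
      have hs : 0 ≤ L - t := by linarith [ht.2]
      rw [sqFlux_zero_of_nonneg α (sq_nonneg _), Real.sqrt_sq (mul_nonneg hm hs)]
      have h1 := mul_le_mul_of_nonneg_left (hG t ⟨ha.trans_lt ht.1, ht.2⟩) hA
      have h2 := mul_le_mul_of_nonneg_left (mul_le_flux hα (mul_nonneg hm hs)
        ((mul_le_mul_of_nonneg_left (by linarith [ht.1]) hm).trans hP)) hB
      have h3 := mul_le_mul_of_nonneg_right hc hs
      nlinarith) L ⟨haL, le_rfl⟩
  simpa using key

/-- The solution of the initial value problem for the squared slope, started at `um`, vanishes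
at `up`. -/
def Connects (f : ℝ → ℝ) (um up α δ ε : ℝ) : Prop :=
  ∃ w, IsSlopeSq α 0 (2 / δ) (2 * ε / δ) (um - up) (fun t => -reaction f um up (um - t)) w ∧
    w (um - up) = 0

theorem exists_slopeSq (hf : ContDiff ℝ 2 f) (hu : up < um) (hα : 1 / 2 < α) (hδ : 0 < δ)
    (hε : 0 ≤ ε) : ∃ w, IsSlopeSq α 0 (2 / δ) (2 * ε / δ) (um - up)
      (fun t => -reaction f um up (um - t)) w := by
  have hc : Continuous (fun t => -reaction f um up (um - t)) :=
    ((continuous_reaction hf).comp (continuous_const.sub continuous_id)).neg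
  obtain ⟨Γ, hΓ⟩ := isCompact_Icc.exists_bound_of_continuousOn (s := Icc 0 (um - up))
    hc.continuousOn
  have hL : 0 ≤ um - up := by linarith
  exact exists_isSlopeSq hα (by positivity) hL hc hΓ
    ((norm_nonneg _).trans (hΓ 0 ⟨le_rfl, hL⟩))

theorem neg_reaction_pos (hf : ContDiff ℝ 2 f) (hf'' : ∀ u : ℝ, 0 < deriv (deriv f) u)
    {t : ℝ} (ht : t ∈ Ioo 0 (um - up)) : 0 < -reaction f um up (um - t) :=
  neg_pos.2 (reaction_neg hf hf'' ⟨by linarith [ht.2], by linarith [ht.1]⟩)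

theorem connects_of_nonpos (hf : ContDiff ℝ 2 f) (hf'' : ∀ u : ℝ, 0 < deriv (deriv f) u)
    (hu : up < um) (hδ : 0 < δ)
    (H : IsSlopeSq α 0 (2 / δ) (2 * ε / δ) (um - up) (fun t => -reaction f um up (um - t)) w)
    (hw : w (um - up) ≤ 0) : Connects f um up α δ ε :=
  ⟨w, H, le_antisymm hw (H.nonneg (by positivity) (fun _ => neg_reaction_pos hf hf'') _
    ⟨by linarith, le_rfl⟩)⟩

theorem Connects.pos (hf : ContDiff ℝ 2 f) (hf'' : ∀ u : ℝ, 0 < deriv (deriv f) u)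
    (hu : up < um) (hδ : 0 < δ) (hε : 0 ≤ ε) (h : Connects f um up α δ ε) : 0 < ε := by
  refine lt_of_le_of_ne hε fun h0 => ?_
  obtain ⟨w, H, hw⟩ := h
  have hL : 0 < um - up := sub_pos.2 hu
  have hmono : StrictMonoOn w (Icc 0 (um - up)) := by
    refine strictMonoOn_of_deriv_pos (convex_Icc _ _) H.continuousOn fun t ht => ?_
    rw [interior_Icc] at ht
    rw [(H.hasDerivAt t ht).deriv, ← h0]
    have := neg_reaction_pos hf hf'' ht
    simp only [mul_zero, zero_div, zero_mul, sub_zero]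
    positivity
  have := hmono ⟨le_rfl, hL.le⟩ ⟨hL.le, le_rfl⟩ hL
  rw [hw, H.zero] at this
  exact lt_irrefl _ this

/-- The value ε = 0 is admitted on the right to make the condition closed; `Connects.pos` excludes
it afterwards. -/
theorem mem_waveSet_iff (hf : ContDiff ℝ 2 f) (hf'' : ∀ u : ℝ, 0 < deriv (deriv f) u)
    (hu : up < um) (hα : 1 / 2 < α) (hδ : 0 < δ) :
    ε ∈ waveSet f um up α δ ↔ 0 ≤ ε ∧ Connects f um up α δ ε := by
  constructor
  · rintro ⟨hε, v, hv⟩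
    obtain ⟨w, H⟩ := exists_slopeSq (ε := ε) hf hu hα hδ hε.le
    exact ⟨hε.le, w, H, hv.slopeSq_eq_zero hα hδ hε.le H⟩
  · rintro ⟨hε, h⟩
    have h0 := h.pos hf hf'' hu hδ hε
    obtain ⟨w, H, hw⟩ := h
    exact ⟨h0, H.exists_isMonotoneWave hf hf'' hu hα hδ h0 hw⟩

theorem exists_connects (hf : ContDiff ℝ 2 f) (hf'' : ∀ u : ℝ, 0 < deriv (deriv f) u)
    (hu : up < um) (hα : 1 / 2 < α) (hδ : 0 < δ) : ∃ ε, 0 ≤ ε ∧ Connects f um up α δ ε := by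
  obtain ⟨c, hc, hcb⟩ := exists_neg_reaction_le hf hu
  have hL : 0 ≤ um - up := by linarith
  set r := (1 + (um - up) ^ 2) ^ (-α) with hr
  have hr0 : 0 < r := by positivity
  -- This gives equality in the condition of `nonpos_of_linear_bound` for m = 1, a = 0.
  set ε := (c + δ) / r with hε
  have hε0 : 0 ≤ ε := by positivity
  obtain ⟨w, H⟩ := exists_slopeSq (ε := ε) hf hu hα hδ hε0
  refine ⟨ε, hε0, connects_of_nonpos hf hf'' hu hδ H ?_⟩
  refine H.nonpos_of_linear_bound hα (a := 0) (m := 1) (c := c) (P := um - up) (by positivity)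
    (by positivity) le_rfl hL zero_le_one (fun t ht => ?_) (by simp) (le_of_eq ?_) ?_
  · have := (hcb (um - t) ⟨by linarith [ht.2], by linarith [ht.1]⟩).1
    linarith
  · rw [← hr, hε]
    field_simp
  · rw [H.zero]; positivity

/-- The value w(L) depends continuously on the coefficients 2/δ and 2ε/δ, which are continuous in
(δ, ε) for δ ≥ δa > 0. -/
theorem isClosed_connects (hf : ContDiff ℝ 2 f) (hu : up < um) (hα : 1 / 2 < α) {δa δb E : ℝ}
    (hδa : 0 < δa) :
    IsClosed {x : ℝ × ℝ | x ∈ Icc δa δb ×ˢ Icc 0 E ∧ Connects f um up α x.1 x.2} := by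
  refine isClosed_of_closure_subset fun x hx => ?_
  have hxK : x ∈ Icc δa δb ×ˢ Icc 0 E :=
    (isClosed_Icc.prod isClosed_Icc).closure_subset_iff.2 (fun y hy => hy.1) hx
  refine ⟨hxK, ?_⟩
  obtain ⟨u, huS, hlim⟩ := mem_closure_iff_seq_limit.1 hx
  have hc : Continuous (fun t => -reaction f um up (um - t)) :=
    ((continuous_reaction hf).comp (continuous_const.sub continuous_id)).neg
  obtain ⟨Γ, hΓ⟩ := isCompact_Icc.exists_bound_of_continuousOn (s := Icc 0 (um - up))
    hc.continuousOn
  have hL : 0 ≤ um - up := by linarith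
  have hmem : um - up ∈ Icc 0 (um - up) := ⟨hL, le_rfl⟩
  have hx0 : 0 < x.1 := hδa.trans_le hxK.1.1
  obtain ⟨w, H⟩ := exists_slopeSq hf hu hα hx0 hxK.2.1
  refine ⟨w, H, ?_⟩
  have hBle : ∀ y ∈ Icc δa δb ×ˢ Icc 0 E, 0 ≤ 2 * y.2 / y.1 ∧ 2 * y.2 / y.1 ≤ 2 * E / δa := by
    intro y hy
    have hy0 : 0 < y.1 := hδa.trans_le hy.1.1
    have hy2 : 0 ≤ y.2 := hy.2.1
    have hE : 0 ≤ E := hy2.trans hy.2.2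
    refine ⟨by positivity, div_le_div₀ (by positivity) (by linarith [hy.2.2]) hδa hy.1.1⟩
  set bound : ℝ × ℝ → ℝ := fun y => (|2 / x.1 - 2 / y.1| * Γ +
    |2 * x.2 / x.1 - 2 * y.2 / y.1| * flux α (critSlope α) +
      2 * E / δa * (2 * α * (√0 + √0))) * (um - up) *
        Real.exp (2 * E / δa * (2 * α) * (um - up)) with hbound
  have hle : ∀ n, |w (um - up)| ≤ bound (u n) := fun n => by
    obtain ⟨hK, wn, Hn, hwn⟩ := huS n
    have := H.abs_sub_le hα Hn le_rfl le_rfl (hBle x hxK).1 (hBle _ hK).1 (hBle x hxK).2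
      (hBle _ hK).2 hΓ ((norm_nonneg _).trans (hΓ 0 ⟨le_rfl, hL⟩)) _ hmem
    rwa [hwn, sub_zero] at this
  have hb0 : bound x = 0 := by simp [hbound]
  have hbc : ContinuousAt bound x := by
    have h1 : ContinuousAt (fun y : ℝ × ℝ => 2 / y.1) x :=
      continuousAt_const.div continuousAt_fst hx0.ne'
    have h2 : ContinuousAt (fun y : ℝ × ℝ => 2 * y.2 / y.1) x :=
      (continuousAt_const.mul continuousAt_snd).div continuousAt_fst hx0.ne'
    exact ((((((continuousAt_const.sub h1).abs).mul continuousAt_const).add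
      (((continuousAt_const.sub h2).abs).mul continuousAt_const)).add continuousAt_const).mul
      continuousAt_const).mul continuousAt_const
  have h1 : Tendsto (fun n => bound (u n)) atTop (𝓝 0) := hb0 ▸ hbc.tendsto.comp hlim
  have h2 := ge_of_tendsto' h1 hle
  exact abs_eq_zero.1 (le_antisymm h2 (abs_nonneg _))

/-- Used twice: with δa = δb for the minimal ε at a fixed δ, and on a genuine interval for the
minimum over δ. -/
theorem exists_min_connects (hf : ContDiff ℝ 2 f) (hu : up < um) (hα : 1 / 2 < α) {δa δb : ℝ}
    (hδa : 0 < δa) (hne : ∃ δ ∈ Icc δa δb, ∃ ε, 0 ≤ ε ∧ Connects f um up α δ ε) :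
    ∃ δ₀ ∈ Icc δa δb, ∃ ε₀, 0 ≤ ε₀ ∧ Connects f um up α δ₀ ε₀ ∧
      ∀ δ ∈ Icc δa δb, ∀ ε, 0 ≤ ε → Connects f um up α δ ε → ε₀ ≤ ε := by
  obtain ⟨δ, hδ, E, hE, hc⟩ := hne
  have hcomp : IsCompact {x : ℝ × ℝ | x ∈ Icc δa δb ×ˢ Icc 0 E ∧ Connects f um up α x.1 x.2} :=
    (isCompact_Icc.prod isCompact_Icc).of_isClosed_subset
      (isClosed_connects hf hu hα hδa) fun x hx => hx.1
  obtain ⟨x, hx, hmin⟩ := hcomp.exists_isMinOn ⟨(δ, E), ⟨hδ, hE, le_rfl⟩, hc⟩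
    continuous_snd.continuousOn
  refine ⟨x.1, hx.1.1, x.2, hx.1.2.1, hx.2, fun δ' hδ' ε hε h => ?_⟩
  rcases le_total ε E with h1 | h1
  · exact hmin (show (δ', ε) ∈ _ from ⟨⟨hδ', hε, h1⟩, h⟩)
  · exact hx.1.2.2.trans h1

theorem isLeast_waveSet (hf : ContDiff ℝ 2 f) (hf'' : ∀ u : ℝ, 0 < deriv (deriv f) u)
    (hu : up < um) (hα : 1 / 2 < α) (hδ : 0 < δ) :
    IsLeast (waveSet f um up α δ) (epsMin f um up α δ) := by
  obtain ⟨δ₀, hδ₀, ε₀, hε₀, hc, hmin⟩ := exists_min_connects hf hu hα hδ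
    ⟨δ, ⟨le_rfl, le_rfl⟩, exists_connects hf hf'' hu hα hδ⟩
  obtain rfl : δ₀ = δ := le_antisymm hδ₀.2 hδ₀.1
  have : IsLeast (waveSet f um up α δ₀) ε₀ :=
    ⟨(mem_waveSet_iff hf hf'' hu hα hδ).2 ⟨hε₀, hc⟩, fun ε hε =>
      have h := (mem_waveSet_iff hf hf'' hu hα hδ).1 hε
      hmin δ₀ hδ₀ ε h.1 h.2⟩
  rwa [epsMin, this.csInf_eq]

/-- With a suitable small dispersion, less dissipation than in the reduced problem suffices. -/
theorem exists_connects_lt (hf : ContDiff ℝ 2 f) (hf'' : ∀ u : ℝ, 0 < deriv (deriv f) u)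
    (hu : up < um) (hα : 1 / 2 < α) {vm a : ℝ} (hvm : vm ∈ Ioo up um) (ha : 0 < a)
    (hmax : ∀ v ∈ Icc up um,
      -reaction f um up v ≤ -reaction f um up vm - a * (v - vm) ^ 2) :
    ∃ δ > 0, ∃ ε, 0 ≤ ε ∧ ε < -reaction f um up vm / flux α (critSlope α) ∧
      Connects f um up α δ ε := by
  obtain ⟨b, hb, hpar⟩ := flux_max_sub_sq_le hα
  obtain ⟨c, hc, hcb⟩ := exists_neg_reaction_le hf hu
  set q := critSlope α with hq
  have hq0 : 0 < q := critSlope_pos hα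
  set M := flux α q with hM
  have hM0 : 0 < M := flux_max_pos hα
  set ε₀ := -reaction f um up vm / M with hε₀
  have hε₀0 : 0 < ε₀ := div_pos (neg_pos.2 (reaction_neg hf hf'' hvm)) hM0
  have hε₀M : ε₀ * M = -reaction f um up vm := div_mul_cancel₀ _ hM0.ne'
  set L := um - up with hL
  have hL0 : 0 < L := sub_pos.2 hu
  -- The first bound keeps the slope q + s(t - (um - vm)) within [q/2, 2q]; the second lets the
  -- parabola below the maximum of G absorb the loss of flux away from q.
  obtain ⟨s, hs, hsL, hsa⟩ : ∃ s > 0, s * L ≤ q / 2 ∧ ε₀ * b * s ^ 2 ≤ a := by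
    refine ⟨min (q / 2 / L) (min 1 (a / (ε₀ * b))), by positivity, ?_, ?_⟩
    · exact (le_div_iff₀ hL0).1 (min_le_left _ _)
    · set s := min (q / 2 / L) (min 1 (a / (ε₀ * b)))
      have h0 : 0 < s := by positivity
      have h1 : s ≤ 1 := (min_le_right _ _).trans (min_le_left _ _)
      have h2 : s ≤ a / (ε₀ * b) := (min_le_right _ _).trans (min_le_right _ _)
      rw [le_div_iff₀ (by positivity)] at h2
      nlinarith [mul_pos hε₀0 hb, mul_pos (mul_pos hε₀0 hb) h0]
  set r := (1 + (2 * q) ^ 2) ^ (-α) with hr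
  have hr0 : 0 < r := by positivity
  obtain ⟨m, hm, hmc, hmL⟩ : ∃ m > 0, c ≤ ε₀ / 4 * r * m ∧ 2 * q ≤ m * L := by
    refine ⟨max (c / (ε₀ / 4 * r)) (2 * q / L), by positivity, ?_, ?_⟩
    · exact (div_le_iff₀' (by positivity)).1 (le_max_left _ _)
    · exact (div_le_iff₀ hL0).1 (le_max_right _ _)
  set δ := ε₀ / 4 * r / m with hδ
  have hδ0 : 0 < δ := by positivity
  have hδm : δ * m = ε₀ / 4 * r := div_mul_cancel₀ _ hm.ne'
  -- The growing slope leaves a surplus of at least δs·q/2 in the supersolution inequality, which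
  -- pays for lowering ε₀ by κ.
  obtain ⟨κ, hκ, hκε, hκδ⟩ : ∃ κ > 0, κ ≤ ε₀ / 2 ∧ κ * M ≤ δ * s * (q / 2) :=
    ⟨min (ε₀ / 2) (δ * s * (q / 2) / M), by positivity, min_le_left _ _,
      (le_div_iff₀ hM0).1 (min_le_right _ _)⟩
  have hε : 0 < ε₀ - κ := by linarith
  obtain ⟨w, H⟩ := exists_slopeSq (ε := ε₀ - κ) hf hu hα hδ0 hε.le
  refine ⟨δ, hδ0, ε₀ - κ, hε.le, by linarith, connects_of_nonpos hf hf'' hu hδ0 H ?_⟩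
  have hp1 : ∀ t ∈ Icc 0 L, q / 2 ≤ q + s * (t - (um - vm)) ∧
      q + s * (t - (um - vm)) ≤ 2 * q := fun t ht => by
    have h1 : s * (t - (um - vm)) ≤ s * L :=
      mul_le_mul_of_nonneg_left (by linarith [ht.2, hvm.2]) hs.le
    have h2 : s * -L ≤ s * (t - (um - vm)) :=
      mul_le_mul_of_nonneg_left (by linarith [ht.1, hvm.1]) hs.le
    constructor <;> linarith
  have hfirst := H.le_of_supersolution hα (by positivity) le_rfl le_rfl
    (z := fun t => (q + s * (t - (um - vm))) ^ 2)
    (z' := fun t => 2 * s * (q + s * (t - (um - vm)))) (by fun_prop)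
    (fun t _ => (((((hasDerivAt_id' t).sub_const (um - vm)).const_mul s).const_add
      q).fun_pow 2).congr_deriv (by norm_num; ring))
    (by rw [H.zero]; positivity) (fun t ht => by
      have ht' := Ioo_subset_Icc_self ht
      obtain ⟨hlo, hhi⟩ := hp1 t ht'
      have h0 : 0 ≤ q + s * (t - (um - vm)) := by linarith
      rw [sqFlux_zero_of_nonneg α (sq_nonneg _), Real.sqrt_sq h0]
      have h1 := hmax (um - t) ⟨by linarith [ht.2], by linarith [ht.1]⟩
      have h2 := hpar _ ⟨h0, hhi⟩
      have h3 : flux α (q + s * (t - (um - vm))) ≤ M := flux_le_max hα h0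
      set F := flux α (q + s * (t - (um - vm)))
      have h4 : -reaction f um up (um - t) - (ε₀ - κ) * F ≤
          δ * s * (q + s * (t - (um - vm))) := by
        have h5 := mul_le_mul_of_nonneg_left h2 hε₀0.le
        have h6 := mul_le_mul_of_nonneg_left h3 hκ.le
        have h7 := mul_le_mul_of_nonneg_right hsa (sq_nonneg (t - (um - vm)))
        have h8 : δ * s * (q / 2) ≤ δ * s * (q + s * (t - (um - vm))) :=
          mul_le_mul_of_nonneg_left hlo (by positivity)
        have h9 : um - t - vm = -(t - (um - vm)) := by ring
        rw [h9, neg_sq] at h1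
        have h10 : ε₀ * (M - b * (q + s * (t - (um - vm)) - q) ^ 2) =
            -reaction f um up vm - ε₀ * b * s ^ 2 * (t - (um - vm)) ^ 2 := by
          rw [← hε₀M]; ring
        linarith
      have h5 := mul_le_mul_of_nonneg_left h4 (show 0 ≤ 2 / δ by positivity)
      have h6 : 2 / δ * (δ * s * (q + s * (t - (um - vm)))) =
          2 * s * (q + s * (t - (um - vm))) := by field_simp
      have h7 : 2 / δ * (-reaction f um up (um - t) - (ε₀ - κ) * F) =
          2 / δ * -reaction f um up (um - t) - 2 * (ε₀ - κ) / δ * F := by ring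
      linarith)
  -- At t = L - 2q/m the line m(L - t) has height 2q, above the first supersolution; from there it
  -- carries w down to 0.
  have hmt : m * (L - (L - 2 * q / m)) = 2 * q := by field_simp; ring
  have ht0 : 0 ≤ L - 2 * q / m := by
    rw [sub_nonneg, div_le_iff₀ hm]; linarith
  have htL : L - 2 * q / m ≤ L := sub_le_self _ (by positivity)
  refine H.nonpos_of_linear_bound hα (c := c) (m := m) (P := 2 * q) (by positivity)
    (by positivity) ht0 htL hm.le (fun t ht => ?_) hmt.le ?_ ?_
  · have := (hcb (um - t) ⟨by linarith [ht.2], by linarith [ht.1]⟩).1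
    linarith
  · rw [← hr]
    have h1 : c + δ * m ^ 2 ≤ (ε₀ - κ) * (m * r) := by
      have h2 : δ * m ^ 2 = ε₀ / 4 * r * m := by rw [← hδm]; ring
      have h3 : ε₀ / 2 * (m * r) ≤ (ε₀ - κ) * (m * r) :=
        mul_le_mul_of_nonneg_right (by linarith) (by positivity)
      linarith
    have h2 := mul_le_mul_of_nonneg_left h1 (show 0 ≤ 2 / δ by positivity)
    have h3 : 2 / δ * (c + δ * m ^ 2) = 2 / δ * c + 2 * m ^ 2 := by field_simp
    have h4 : 2 / δ * ((ε₀ - κ) * (m * r)) = 2 * (ε₀ - κ) / δ * (m * r) := by ring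
    linarith
  · rw [hmt]
    have h1 := hp1 _ ⟨ht0, htL⟩
    refine (hfirst _ ⟨ht0, htL⟩).trans ?_
    exact pow_le_pow_left₀ (by linarith [h1.1]) h1.2 2

end

end RosenauKdV

/-! ### Assembling the shape of the minimal dissipation -/

open RosenauKdV

theorem mainTheorem12 (f : ℝ → ℝ) (hf : ContDiff ℝ 2 f) (hf'' : ∀ u : ℝ, 0 < deriv (deriv f) u)
    (um up : ℝ) (hu : up < um) (α : ℝ) (hα : 1 / 2 < α) :
    -- both minimal values exist as genuine minima
    (∀ δ : ℝ, 0 < δ →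
      IsLeast (RosenauKdV.waveSet f um up α δ) (RosenauKdV.epsMin f um up α δ)) ∧
    IsLeast (RosenauKdV.reducedWaveSet f um up α) (RosenauKdV.epsMinReduced f um up α) ∧
    -- the strict inequality
    (⨅ δ : Set.Ioi (0 : ℝ), RosenauKdV.epsMin f um up α (δ : ℝ)) <
      RosenauKdV.epsMinReduced f um up α ∧
    -- neither increasing nor decreasing in `δ`
    ¬ MonotoneOn (fun δ : ℝ => RosenauKdV.epsMin f um up α δ) (Set.Ioi 0) ∧
    ¬ AntitoneOn (fun δ : ℝ => RosenauKdV.epsMin f um up α δ) (Set.Ioi 0) ∧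
    -- the infimum is attained at an interior point
    (∃ δ₀ : ℝ, 0 < δ₀ ∧
      IsMinOn (fun δ : ℝ => RosenauKdV.epsMin f um up α δ) (Set.Ioi 0) δ₀) := by
  obtain ⟨vm, hvm, a, ha, hmax⟩ := exists_isMax_neg_reaction hf hf'' hu
  have hmin := fun {δ : ℝ} (hδ : 0 < δ) => isLeast_waveSet (α := α) hf hf'' hu hα hδ
  have hred : IsLeast (reducedWaveSet f um up α)
      (-reaction f um up vm / flux α (critSlope α)) :=
    isLeast_reducedWaveSet hf hf'' hu hα hvm fun x hx =>
      (hmax x hx).trans (sub_le_self _ (mul_nonneg ha.le (sq_nonneg _)))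
  have hred_eq : epsMinReduced f um up α = -reaction f um up vm / flux α (critSlope α) :=
    hred.csInf_eq
  obtain ⟨δ₂, hδ₂, ε₂, hε₂, hlt, hconn⟩ := exists_connects_lt hf hf'' hu hα hvm ha hmax
  have hle₂ : epsMin f um up α δ₂ ≤ ε₂ :=
    (hmin hδ₂).2 ((mem_waveSet_iff hf hf'' hu hα hδ₂).2 ⟨hε₂, hconn⟩)
  -- A level strictly between the value reached at `δ₂` and the reduced minimum: the minimal ε
  -- exceeds it for small δ.
  obtain ⟨ε₁, hε₂₁, hε₁⟩ := exists_between hlt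
  obtain ⟨δ₁, hδ₁, hsmall⟩ := exists_forall_lt_of_isMonotoneWave hf hf'' hα hvm
    ((lt_div_iff₀ (flux_max_pos hα)).1 hε₁)
  obtain ⟨k, hk, hlarge⟩ := exists_mul_le_sq_of_isMonotoneWave hf hf'' hu hα
  have hsmall' : ∀ δ, 0 < δ → δ < δ₁ → epsMin f um up α δ₂ < epsMin f um up α δ :=
    fun δ hδ hδ' => by
      obtain ⟨hε, v, hv⟩ := (hmin hδ).1
      exact (hle₂.trans_lt hε₂₁).trans (hsmall δ _ hδ hδ' hε v hv)
  have hlarge' : ∀ δ, 0 < δ → k * δ ≤ epsMin f um up α δ ^ 2 := fun δ hδ => by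
    obtain ⟨hε, v, hv⟩ := (hmin hδ).1
    exact hlarge δ _ hδ hε v hv
  have hpos : ∀ δ, 0 < δ → 0 < epsMin f um up α δ := fun δ hδ => (hmin hδ).1.1
  set E := epsMin f um up α δ₂ with hE
  have hE0 : 0 < E := hpos δ₂ hδ₂
  have hlarge'' : ∀ δ, 0 < δ → E ^ 2 / k < δ → E < epsMin f um up α δ := fun δ hδ h => by
    rw [div_lt_iff₀' hk] at h
    exact lt_of_pow_lt_pow_left₀ 2 (hpos δ hδ).le (h.trans_le (hlarge' δ hδ))
  refine ⟨fun δ hδ => hmin hδ, hred_eq ▸ hred, ?_, fun hmono => ?_, fun hanti => ?_, ?_⟩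
  · rw [hred_eq]
    refine (ciInf_le ⟨0, ?_⟩ (⟨δ₂, hδ₂⟩ : Set.Ioi (0 : ℝ))).trans_lt (hle₂.trans_lt hlt)
    rintro _ ⟨δ, rfl⟩
    exact (hpos _ δ.2).le
  · obtain ⟨δ, h0, h1⟩ := exists_between (lt_min hδ₁ hδ₂)
    exact (hsmall' δ h0 (h1.trans_le (min_le_left _ _))).not_ge
      (hmono h0 hδ₂ (h1.le.trans (min_le_right _ _)))
  · obtain ⟨δ, h1⟩ := exists_gt (max δ₂ (E ^ 2 / k))
    have h2 : δ₂ < δ := (le_max_left _ _).trans_lt h1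
    exact (hlarge'' δ (hδ₂.trans h2) ((le_max_right _ _).trans_lt h1)).not_ge
      (hanti hδ₂ (hδ₂.trans h2) h2.le)
  -- Outside this compact interval the minimal ε exceeds its value at `δ₂`, which lies inside, so
  -- the minimum over the interval is global.
  · have hδa : 0 < min δ₁ δ₂ := lt_min hδ₁ hδ₂
    have hmem₂ : δ₂ ∈ Set.Icc (min δ₁ δ₂) (max δ₂ (E ^ 2 / k)) :=
      ⟨min_le_right _ _, le_max_left _ _⟩
    obtain ⟨δ₀, hδ₀, ε₀, hε₀, hc, hleast⟩ := exists_min_connects (α := α) hf hu hα hδa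
      ⟨δ₂, hmem₂, ε₂, hε₂, hconn⟩
    have hδ₀0 : 0 < δ₀ := hδa.trans_le hδ₀.1
    have h1 : epsMin f um up α δ₀ ≤ ε₀ :=
      (hmin hδ₀0).2 ((mem_waveSet_iff hf hf'' hu hα hδ₀0).2 ⟨hε₀, hc⟩)
    have h2 : ∀ δ ∈ Set.Icc (min δ₁ δ₂) (max δ₂ (E ^ 2 / k)),
        epsMin f um up α δ₀ ≤ epsMin f um up α δ := fun δ hδ => by
      have h3 := (mem_waveSet_iff hf hf'' hu hα (hδa.trans_le hδ.1)).1 (hmin (hδa.trans_le hδ.1)).1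
      exact h1.trans (hleast δ hδ _ h3.1 h3.2)
    refine ⟨δ₀, hδ₀0, fun δ hδ => ?_⟩
    have hδ : 0 < δ := hδ
    change epsMin f um up α δ₀ ≤ epsMin f um up α δ
    by_cases hlo : δ < min δ₁ δ₂
    · exact (h2 δ₂ hmem₂).trans (hsmall' δ hδ (hlo.trans_le (min_le_left _ _))).le
    by_cases hhi : max δ₂ (E ^ 2 / k) < δ
    · exact (h2 δ₂ hmem₂).trans (hlarge'' δ hδ ((le_max_right _ _).trans_lt hhi)).le
    exact h2 δ ⟨not_lt.1 hlo, not_lt.1 hhi⟩
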